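/- Let $\mathbb K=\mathbb R$ or $\mathbb C$, let $U\subseteq\mathbb K^3$ be open and connected (coordinates $(x,y,u)$), and let $W\subseteq\mathbb K^4$ be open (coordinates $(x,y,u,u_1)$) with $(x,y,u,0)\in W$ for all $(x,y,u)\in U$. Let $F_1,F_2:U\to\mathbb K$ and $F_3,G:W\to\mathbb K$ be analytic, with $F_2\neq 0$ everywhere on $U$, and consider for $u=u(x,y)$ the system $$(S)\qquad u_y=F,\quad F:=F_1(x,y,u)\,u_x+F_2(x,y,u)\,u_x^2+F_3(x,y,u,u_x)\,u_x^3,\qquad u_{xxx}=G(x,y,u,u_x).$$ Write $u_1,u_2,u_{11},u_{12},\dots$ for the jet coordinates corresponding to $u_x,u_y,u_{xx},u_{xy},\dots$, and $D_x,D_y$ for the total derivatives. For a vector field $V=\xi\,\partial_x+\tau\,\partial_y+\phi\,\partial_u$ on $U$ let $\mathrm{Pr}^{(3)}V$ be its third prolongation to the space of 3-jets, i.e. the vector field with components $\xi,\tau,\phi$ and $\phi^{J}$ ($1\le|J|\le 3$), where $\phi^{J,i}=D_i\phi^J-u_{J,1}D_i\xi-u_{J,2}D_i\tau$. An *infinitesimal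 Lie symmetry* of $(S)$ is a vector field $V$ on $U$ with $C^\infty$ coefficients $\xi,\tau,\phi$ of $(x,y,u)$ (holomorphic if $\mathbb K=\mathbb C$) such that $$\mathrm{Pr}^{(3)}V(u_2-F)=0\quad\text{and}\quad \mathrm{Pr}^{(3)}V(u_{111}-G)=0$$ at every 3-jet with $(x,y,u)\in U$, $(x,y,u,u_1)\in W$ that satisfies $u_2=F$, $u_{111}=G$ and the equations obtained from $u_2=F$ by one or two total differentiations. The infinitesimal Lie symmetries form a $\mathbb K$-vector space, the Lie symmetry algebra of $(S)$. **Theorem.** Let $z_0\in U$. Any infinitesimal Lie symmetry $V=\xi\,\partial_x+\tau\,\partial_y+\phi\,\partial_u$ of $(S)$ is uniquely determined on $U$ by the ten values $$\big(\xi,\ \tau,\ \phi,\ \xi_x,\ \tau_x,\ \phi_x,\ \phi_u,\ \xi_{xx},\ \tau_{xx},\ \phi_{xx}\big)(z_0):$$ two infinitesimal Lie symmetries with the same ten values at $z_0$ coincide on $U$. Consequently the Lie symmetry algebra of $(S)$ has dimension at most $10$ over $\mathbb K$. -/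

import Mathlib

open scoped ContDiff

namespace LieSymmetry

/-- The space of the variables `(x, y, u)`: two independent and one dependent variable. -/
abbrev Pt (𝕜 : Type*) := 𝕜 × 𝕜 × 𝕜

/-- Names of the coordinates of the third jet space of functions `u = u(x, y)`
(index `1` stands for a derivative in `x`, index `2` for a derivative in `y`). -/
inductive Coord
  | x | y | u | u1 | u2 | u11 | u12 | u22 | u111 | u112 | u122 | u222
  deriving DecidableEq

instance : Fintype Coord :=
  ⟨{.x, .y, .u, .u1, .u2, .u11, .u12, .u22, .u111, .u112, .u122, .u222}, fun c => by
    cases c <;> simp⟩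

/-- The third jet space. -/
abbrev Jet (𝕜 : Type*) := Coord → 𝕜

/-- The data of the system
`u_y = F1(x,y,u) u_x + F2(x,y,u) u_x² + F3(x,y,u,u_x) u_x³`, `u_xxx = G(x,y,u,u_x)`,
with `F1`, `F2` considered on `U` and `F3`, `G` considered on `W`. -/
structure System (𝕜 : Type*) where
  U : Set (Pt 𝕜)
  W : Set (𝕜 × 𝕜 × 𝕜 × 𝕜)
  F1 : Pt 𝕜 → 𝕜
  F2 : Pt 𝕜 → 𝕜
  F3 : 𝕜 × 𝕜 × 𝕜 × 𝕜 → 𝕜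
  G : 𝕜 × 𝕜 × 𝕜 × 𝕜 → 𝕜

noncomputable section

variable {𝕜 : Type*} [RCLike 𝕜]

/-- The point `(x, y, u)` below a jet. -/
def base (j : Jet 𝕜) : Pt 𝕜 := (j .x, j .y, j .u)

/-- The point `(x, y, u, u_1)` below a jet. -/
def base1 (j : Jet 𝕜) : 𝕜 × 𝕜 × 𝕜 × 𝕜 := (j .x, j .y, j .u, j .u1)

/-- The vector field `∂_x + u_1 ∂_u + u_11 ∂_{u_1} + u_12 ∂_{u_2} + …`, cut off so that it
lives on the third jet space. It is only applied to functions of the second-order jet. -/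
def dirX (j : Jet 𝕜) : Jet 𝕜
  | .x => 1
  | .y => 0
  | .u => j .u1
  | .u1 => j .u11
  | .u2 => j .u12
  | .u11 => j .u111
  | .u12 => j .u112
  | .u22 => j .u122
  | _ => 0

/-- The vector field `∂_y + u_2 ∂_u + u_12 ∂_{u_1} + u_22 ∂_{u_2} + …`, cut off so that it
lives on the third jet space. It is only applied to functions of the second-order jet. -/
def dirY (j : Jet 𝕜) : Jet 𝕜
  | .x => 0
  | .y => 1
  | .u => j .u2
  | .u1 => j .u12
  | .u2 => j .u22
  | .u11 => j .u112
  | .u12 => j .u122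
  | .u22 => j .u222
  | _ => 0

/-- Derivative of a function along a vector field on the jet space: `along dirX` and
`along dirY` are the total derivatives `D_x` and `D_y` (for functions of order at most two). -/
def along (T : Jet 𝕜 → Jet 𝕜) (f : Jet 𝕜 → 𝕜) (j : Jet 𝕜) : 𝕜 := fderiv 𝕜 f j (T j)

/-- The three components of a vector field `V = ξ ∂_x + τ ∂_y + φ ∂_u`. -/
def xi (V : Pt 𝕜 → Pt 𝕜) (z : Pt 𝕜) : 𝕜 := (V z).1

def tau (V : Pt 𝕜 → Pt 𝕜) (z : Pt 𝕜) : 𝕜 := (V z).2.1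

def phi (V : Pt 𝕜 → Pt 𝕜) (z : Pt 𝕜) : 𝕜 := (V z).2.2

/-- One step of the prolongation formula,
`φ^{J,i} = D_i φ^J - u_{J,1} D_i ξ - u_{J,2} D_i τ`, where `T` is the direction `i`,
`f = φ^J`, `c1 = u_{J,1}` and `c2 = u_{J,2}`. -/
def prolStep (T : Jet 𝕜 → Jet 𝕜) (V : Pt 𝕜 → Pt 𝕜) (f : Jet 𝕜 → 𝕜) (c1 c2 : Coord)
    (j : Jet 𝕜) : 𝕜 :=
  along T f j - j c1 * along T (fun i => xi V (base i)) j
    - j c2 * along T (fun i => tau V (base i)) j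

def phi0 (V : Pt 𝕜 → Pt 𝕜) (j : Jet 𝕜) : 𝕜 := phi V (base j)

def phiX (V : Pt 𝕜 → Pt 𝕜) : Jet 𝕜 → 𝕜 := prolStep dirX V (phi0 V) .u1 .u2

def phiY (V : Pt 𝕜 → Pt 𝕜) : Jet 𝕜 → 𝕜 := prolStep dirY V (phi0 V) .u1 .u2

def phiXX (V : Pt 𝕜 → Pt 𝕜) : Jet 𝕜 → 𝕜 := prolStep dirX V (phiX V) .u11 .u12

def phiXY (V : Pt 𝕜 → Pt 𝕜) : Jet 𝕜 → 𝕜 := prolStep dirY V (phiX V) .u11 .u12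

def phiYY (V : Pt 𝕜 → Pt 𝕜) : Jet 𝕜 → 𝕜 := prolStep dirY V (phiY V) .u12 .u22

def phiXXX (V : Pt 𝕜 → Pt 𝕜) : Jet 𝕜 → 𝕜 := prolStep dirX V (phiXX V) .u111 .u112

def phiXXY (V : Pt 𝕜 → Pt 𝕜) : Jet 𝕜 → 𝕜 := prolStep dirY V (phiXX V) .u111 .u112

def phiXYY (V : Pt 𝕜 → Pt 𝕜) : Jet 𝕜 → 𝕜 := prolStep dirY V (phiXY V) .u112 .u122

def phiYYY (V : Pt 𝕜 → Pt 𝕜) : Jet 𝕜 → 𝕜 := prolStep dirY V (phiYY V) .u122 .u222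

/-- The third prolongation of `V`, a vector field on the third jet space. -/
def prolong (V : Pt 𝕜 → Pt 𝕜) (j : Jet 𝕜) : Jet 𝕜
  | .x => xi V (base j)
  | .y => tau V (base j)
  | .u => phi0 V j
  | .u1 => phiX V j
  | .u2 => phiY V j
  | .u11 => phiXX V j
  | .u12 => phiXY V j
  | .u22 => phiYY V j
  | .u111 => phiXXX V j
  | .u112 => phiXXY V j
  | .u122 => phiXYY V j
  | .u222 => phiYYY V j

namespace System

/-- The first equation, as a function on the jet space:
`u_2 - (F1 u_1 + F2 u_1² + F3 u_1³)`. -/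
def eq1 (S : System 𝕜) (j : Jet 𝕜) : 𝕜 :=
  j .u2 - (S.F1 (base j) * j .u1 + S.F2 (base j) * j .u1 ^ 2 + S.F3 (base1 j) * j .u1 ^ 3)

/-- The second equation, as a function on the jet space: `u_111 - G`. -/
def eq2 (S : System 𝕜) (j : Jet 𝕜) : 𝕜 := j .u111 - S.G (base1 j)

/-- The 3-jets (over the domain of the system) that satisfy the two equations and the total
derivatives of order at most two of the first equation. -/
def variety (S : System 𝕜) : Set (Jet 𝕜) :=
  {j | base j ∈ S.U ∧ base1 j ∈ S.W ∧
    S.eq1 j = 0 ∧ along dirX S.eq1 j = 0 ∧ along dirY S.eq1 j = 0 ∧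
    along dirX (along dirX S.eq1) j = 0 ∧ along dirX (along dirY S.eq1) j = 0 ∧
    along dirY (along dirY S.eq1) j = 0 ∧ S.eq2 j = 0}

/-- Infinitesimal Lie symmetries: smooth vector fields `ξ ∂_x + τ ∂_y + φ ∂_u` on `U` whose
third prolongation annihilates both equations along the system. -/
def IsSymmetry (S : System 𝕜) (V : Pt 𝕜 → Pt 𝕜) : Prop :=
  ContDiffOn 𝕜 ∞ V S.U ∧
    ∀ j ∈ S.variety, fderiv 𝕜 S.eq1 j (prolong V j) = 0 ∧ fderiv 𝕜 S.eq2 j (prolong V j) = 0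

end System

/-- Partial derivative in `x` of a function of `(x, y, u)`. -/
def partialX (f : Pt 𝕜 → 𝕜) (z : Pt 𝕜) : 𝕜 := fderiv 𝕜 f z (1, 0, 0)

/-- Partial derivative in `u` of a function of `(x, y, u)`. -/
def partialU (f : Pt 𝕜 → 𝕜) (z : Pt 𝕜) : 𝕜 := fderiv 𝕜 f z (0, 0, 1)

/-- The ten initial Taylor coefficients
`(ξ, τ, φ, ξ_x, τ_x, φ_x, φ_u, ξ_xx, τ_xx, φ_xx)` of `V` at a point. -/
def initialTaylorCoeffs (V : Pt 𝕜 → Pt 𝕜) (z : Pt 𝕜) : Fin 10 → 𝕜 :=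
  ![xi V z, tau V z, phi V z,
    partialX (xi V) z, partialX (tau V) z, partialX (phi V) z, partialU (phi V) z,
    partialX (partialX (xi V)) z, partialX (partialX (tau V)) z, partialX (partialX (phi V)) z]

/-! Linearity of the prolongation, needed for the vector space structure on symmetries. -/

/-- `h = a f + b g` on `O`, where `f` and `g` are smooth on `O`. -/
def Comb (O : Set (Jet 𝕜)) (a b : 𝕜) (f g h : Jet 𝕜 → 𝕜) : Prop :=
  ContDiffOn 𝕜 ∞ f O ∧ ContDiffOn 𝕜 ∞ g O ∧ ∀ j ∈ O, h j = a * f j + b * g j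

theorem contDiff_base : ContDiff 𝕜 ∞ (base : Jet 𝕜 → Pt 𝕜) := by
  unfold base; fun_prop

theorem contDiff_dirX : ContDiff 𝕜 ∞ (dirX : Jet 𝕜 → Jet 𝕜) := by
  rw [contDiff_pi]
  intro c
  cases c <;> simp only [dirX] <;> fun_prop

theorem contDiff_dirY : ContDiff 𝕜 ∞ (dirY : Jet 𝕜 → Jet 𝕜) := by
  rw [contDiff_pi]
  intro c
  cases c <;> simp only [dirY] <;> fun_prop

theorem contDiffOn_along {O : Set (Jet 𝕜)} (hO : IsOpen O) {T : Jet 𝕜 → Jet 𝕜}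
    (hT : ContDiff 𝕜 ∞ T) {f : Jet 𝕜 → 𝕜} (hf : ContDiffOn 𝕜 ∞ f O) :
    ContDiffOn 𝕜 ∞ (along T f) O :=
  (hf.fderiv_of_isOpen hO (by simp)).clm_apply hT.contDiffOn

theorem Comb.along {O : Set (Jet 𝕜)} (hO : IsOpen O) {T : Jet 𝕜 → Jet 𝕜}
    (hT : ContDiff 𝕜 ∞ T) {a b : 𝕜} {f g h : Jet 𝕜 → 𝕜} (H : Comb O a b f g h) :
    Comb O a b (along T f) (along T g) (along T h) := by
  obtain ⟨hf, hg, hh⟩ := H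
  refine ⟨contDiffOn_along hO hT hf, contDiffOn_along hO hT hg, fun j hj => ?_⟩
  have hn : O ∈ nhds j := hO.mem_nhds hj
  have e : h =ᶠ[nhds j] fun i => a * f i + b * g i := by
    filter_upwards [hn] with i hi using hh i hi
  have df : DifferentiableAt 𝕜 f j := (hf.contDiffAt hn).differentiableAt (by simp)
  have dg : DifferentiableAt 𝕜 g j := (hg.contDiffAt hn).differentiableAt (by simp)
  have := ((df.hasFDerivAt.const_mul a).add (dg.hasFDerivAt.const_mul b)).congr_of_eventuallyEq e
  simp [LieSymmetry.along, this.fderiv]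

theorem Comb.prolStep {O : Set (Jet 𝕜)} (hO : IsOpen O) {T : Jet 𝕜 → Jet 𝕜}
    (hT : ContDiff 𝕜 ∞ T) {a b : 𝕜} {V₁ V₂ V : Pt 𝕜 → Pt 𝕜}
    (hx : Comb O a b (fun i => xi V₁ (base i)) (fun i => xi V₂ (base i)) (fun i => xi V (base i)))
    (ht : Comb O a b (fun i => tau V₁ (base i)) (fun i => tau V₂ (base i))
      (fun i => tau V (base i)))
    {f g h : Jet 𝕜 → 𝕜} (H : Comb O a b f g h) (c1 c2 : Coord) :
    Comb O a b (prolStep T V₁ f c1 c2) (prolStep T V₂ g c1 c2) (prolStep T V h c1 c2) := by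
  obtain ⟨x1, x2, x3⟩ := hx.along hO hT
  obtain ⟨t1, t2, t3⟩ := ht.along hO hT
  obtain ⟨f1, f2, f3⟩ := H.along hO hT
  have p : ∀ c : Coord, ContDiffOn 𝕜 ∞ (fun i : Jet 𝕜 => i c) O := fun c => by fun_prop
  refine ⟨(f1.sub ((p c1).mul x1)).sub ((p c2).mul t1),
    (f2.sub ((p c1).mul x2)).sub ((p c2).mul t2), fun j hj => ?_⟩
  simp only [LieSymmetry.prolStep, x3 j hj, t3 j hj, f3 j hj]
  ring

theorem prolong_comb {U : Set (Pt 𝕜)} (hU : IsOpen U) {V₁ V₂ : Pt 𝕜 → Pt 𝕜}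
    (h₁ : ContDiffOn 𝕜 ∞ V₁ U) (h₂ : ContDiffOn 𝕜 ∞ V₂ U) (a b : 𝕜) {j : Jet 𝕜}
    (hj : base j ∈ U) :
    prolong (fun z => a • V₁ z + b • V₂ z) j = a • prolong V₁ j + b • prolong V₂ j := by
  have hO : IsOpen (base ⁻¹' U : Set (Jet 𝕜)) := hU.preimage contDiff_base.continuous
  have m : Set.MapsTo (base : Jet 𝕜 → Pt 𝕜) (base ⁻¹' U) U := fun _ h => h
  have c₁ := h₁.comp contDiff_base.contDiffOn m
  have c₂ := h₂.comp contDiff_base.contDiffOn m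
  have hx : Comb (base ⁻¹' U) a b (fun i => xi V₁ (base i)) (fun i => xi V₂ (base i))
      (fun i => xi (fun z => a • V₁ z + b • V₂ z) (base i)) :=
    ⟨c₁.fst, c₂.fst, fun _ _ => by simp [xi]⟩
  have ht : Comb (base ⁻¹' U) a b (fun i => tau V₁ (base i)) (fun i => tau V₂ (base i))
      (fun i => tau (fun z => a • V₁ z + b • V₂ z) (base i)) :=
    ⟨c₁.snd.fst, c₂.snd.fst, fun _ _ => by simp [tau]⟩
  have h0 : Comb (base ⁻¹' U) a b (phi0 V₁) (phi0 V₂)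
      (phi0 (fun z => a • V₁ z + b • V₂ z)) :=
    ⟨c₁.snd.snd, c₂.snd.snd, fun _ _ => by simp [phi0, phi]⟩
  have hX := Comb.prolStep hO contDiff_dirX hx ht h0 .u1 .u2
  have hY := Comb.prolStep hO contDiff_dirY hx ht h0 .u1 .u2
  have hXX := Comb.prolStep hO contDiff_dirX hx ht hX .u11 .u12
  have hXY := Comb.prolStep hO contDiff_dirY hx ht hX .u11 .u12
  have hYY := Comb.prolStep hO contDiff_dirY hx ht hY .u12 .u22
  have hXXX := Comb.prolStep hO contDiff_dirX hx ht hXX .u111 .u112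
  have hXXY := Comb.prolStep hO contDiff_dirY hx ht hXX .u111 .u112
  have hXYY := Comb.prolStep hO contDiff_dirY hx ht hXY .u112 .u122
  have hYYY := Comb.prolStep hO contDiff_dirY hx ht hYY .u122 .u222
  funext c
  cases c
  · exact hx.2.2 j hj
  · exact ht.2.2 j hj
  · exact h0.2.2 j hj
  · exact hX.2.2 j hj
  · exact hY.2.2 j hj
  · exact hXX.2.2 j hj
  · exact hXY.2.2 j hj
  · exact hYY.2.2 j hj
  · exact hXXX.2.2 j hj
  · exact hXXY.2.2 j hj
  · exact hXYY.2.2 j hj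
  · exact hYYY.2.2 j hj

namespace System

theorem IsSymmetry.comb {S : System 𝕜} (hU : IsOpen S.U) {V₁ V₂ : Pt 𝕜 → Pt 𝕜}
    (h₁ : S.IsSymmetry V₁) (h₂ : S.IsSymmetry V₂) (a b : 𝕜) :
    S.IsSymmetry (fun z => a • V₁ z + b • V₂ z) := by
  refine ⟨(h₁.1.const_smul a).add (h₂.1.const_smul b), fun j hj => ?_⟩
  rw [prolong_comb hU h₁.1 h₂.1 a b hj.1]
  simp [h₁.2 j hj, h₂.2 j hj]

theorem isSymmetry_zero {S : System 𝕜} (hU : IsOpen S.U) : S.IsSymmetry (fun _ => 0) := by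
  have h0 : ContDiffOn 𝕜 ∞ (fun _ => 0 : Pt 𝕜 → Pt 𝕜) S.U := contDiffOn_const
  refine ⟨h0, fun j hj => ?_⟩
  have := prolong_comb hU h0 h0 0 0 hj.1
  simp only [smul_zero, add_zero, zero_smul] at this
  simp [this]

/-- The Lie symmetry algebra: the vector space of all infinitesimal Lie symmetries, as
vector fields on `U` (functions on the subtype `U`, so that two symmetries are equal exactly
when they agree on `U`). -/
def symmetryAlgebra (S : System 𝕜) (hU : IsOpen S.U) : Submodule 𝕜 (S.U → Pt 𝕜) where
  carrier := {v | ∃ V, S.IsSymmetry V ∧ ∀ z : S.U, v z = V z}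
  zero_mem' := ⟨_, isSymmetry_zero hU, fun _ => rfl⟩
  add_mem' := by
    rintro v w ⟨V, hV, hv⟩ ⟨W, hW, hw⟩
    exact ⟨_, hV.comb hU hW 1 1, fun z => by simp [hv z, hw z]⟩
  smul_mem' := by
    rintro a v ⟨V, hV, hv⟩
    exact ⟨_, hV.comb hU hV a 0, fun z => by simp [hv z]⟩

end System

end

end LieSymmetry

/-!
Over `ℝ` or `ℂ`, the components of a symmetry satisfy a closed linear system of finite type, and
such a system propagates the vanishing of its unknowns from one point to the whole of `U`.

Restrict both determining equations to the variety of the system: the first becomes an identity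
between functions of `(x, y, u, p)`, where `p = u_1`, and the second a polynomial of degree two in
the free coordinate `r = u_11`, so each of its three coefficients vanishes. Comparing in every
identity the coefficients of `1` and `p` at `p = 0`, where `F = F1 p + F2 p² + O(p³)`, gives two
relations between derivatives of `ξ, τ, φ` at the points of `U`:

* `r²` gives `ξ_u` and (dividing by `F2`) `τ_u`, the first equation `φ_y`, `ξ_y` and (dividing by
  `F2`) `τ_y`, all in terms of `ξ, τ, φ, ξ_x, τ_x, φ_x, φ_u`;
* `r` gives `φ_xu` and `φ_uu` in terms of these seven and `ξ_xx, τ_xx, φ_xx`;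
* the two ways of computing `φ_xuu` give `τ_xxx` (dividing by `F2`), and `r⁰` gives `φ_xxx` and,
  with the `x`-derivative of the relation for `φ_xu`, also `ξ_xxx`.

Hence all first derivatives of the ten initial Taylor coefficients are linear combinations of
those ten with smooth coefficients. On a segment this is a linear ordinary differential equation,
so the set on which all ten vanish is open and closed in `U`.
-/

namespace LieSymmetry

noncomputable section

variable {𝕜 : Type*} [RCLike 𝕜]

section DerivAlong

variable {E E' : Type*} [NormedAddCommGroup E] [NormedSpace 𝕜 E]
  [NormedAddCommGroup E'] [NormedSpace 𝕜 E']
  {O : Set E} {T : E → E} {f f' g g' : E → 𝕜} {z : E}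

/-- Derivative of `f` along the vector field `T`. The operators `along`, `partialX` and `partialU`
are definitionally of this form. -/
def derivAlong (T : E → E) (f : E → 𝕜) (z : E) : 𝕜 := fderiv 𝕜 f z (T z)

/-- On `O`, the function `f` is differentiable, with derivative `f'` along the vector field `T`. -/
def HasDerivAlongOn (T : E → E) (f f' : E → 𝕜) (O : Set E) : Prop :=
  ∀ z ∈ O, DifferentiableAt 𝕜 f z ∧ derivAlong T f z = f' z

namespace HasDerivAlongOn

theorem derivAlong_eq (hf : HasDerivAlongOn T f f' O) (hz : z ∈ O) : derivAlong T f z = f' z :=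
  (hf z hz).2

theorem const (c : 𝕜) : HasDerivAlongOn T (fun _ => c) (fun _ => 0) O := fun z _ => by
  simp [derivAlong]

theorem add (hf : HasDerivAlongOn T f f' O) (hg : HasDerivAlongOn T g g' O) :
    HasDerivAlongOn T (fun z => f z + g z) (fun z => f' z + g' z) O := fun z hz => by
  refine ⟨(hf z hz).1.add (hg z hz).1, ?_⟩
  simp only [derivAlong, ← hf.derivAlong_eq hz, ← hg.derivAlong_eq hz,
    fderiv_fun_add (hf z hz).1 (hg z hz).1]
  rfl

theorem sub (hf : HasDerivAlongOn T f f' O) (hg : HasDerivAlongOn T g g' O) :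
    HasDerivAlongOn T (fun z => f z - g z) (fun z => f' z - g' z) O := fun z hz => by
  refine ⟨(hf z hz).1.sub (hg z hz).1, ?_⟩
  simp only [derivAlong, ← hf.derivAlong_eq hz, ← hg.derivAlong_eq hz,
    fderiv_fun_sub (hf z hz).1 (hg z hz).1]
  rfl

theorem mul (hf : HasDerivAlongOn T f f' O) (hg : HasDerivAlongOn T g g' O) :
    HasDerivAlongOn T (fun z => f z * g z) (fun z => f' z * g z + f z * g' z) O := fun z hz => by
  refine ⟨(hf z hz).1.mul (hg z hz).1, ?_⟩
  simp only [derivAlong, ← hf.derivAlong_eq hz, ← hg.derivAlong_eq hz,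
    fderiv_fun_mul (hf z hz).1 (hg z hz).1]
  simp only [add_apply, smul_apply, smul_eq_mul]
  ring

theorem congr_deriv (hf : HasDerivAlongOn T f f' O) (h : ∀ z ∈ O, g' z = f' z) :
    HasDerivAlongOn T f g' O := fun z hz => ⟨(hf z hz).1, by rw [(hf z hz).2, h z hz]⟩

theorem congr (hf : HasDerivAlongOn T f f' O) (hO : IsOpen O) (h : ∀ z ∈ O, g z = f z) :
    HasDerivAlongOn T g f' O := fun z hz => by
  have hgf : g =ᶠ[nhds z] f := Filter.eventually_of_mem (hO.mem_nhds hz) h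
  exact ⟨(hf z hz).1.congr_of_eventuallyEq hgf,
    by rw [← hf.derivAlong_eq hz, derivAlong, derivAlong, hgf.fderiv_eq]⟩

end HasDerivAlongOn

theorem differentiableAt_of_contDiffOn (hO : IsOpen O) (hf : ContDiffOn 𝕜 ∞ f O) (hz : z ∈ O) :
    DifferentiableAt 𝕜 f z :=
  (hf.contDiffAt (hO.mem_nhds hz)).differentiableAt (by simp)

theorem contDiffOn_derivAlong (hO : IsOpen O) (hT : ContDiff 𝕜 ∞ T) (hf : ContDiffOn 𝕜 ∞ f O) :
    ContDiffOn 𝕜 ∞ (derivAlong T f) O :=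
  (hf.fderiv_of_isOpen hO (by simp)).clm_apply hT.contDiffOn

theorem hasDerivAlongOn_derivAlong (hO : IsOpen O) (hf : ContDiffOn 𝕜 ∞ f O) (T : E → E) :
    HasDerivAlongOn T f (derivAlong T f) O := fun _ hz =>
  ⟨differentiableAt_of_contDiffOn hO hf hz, rfl⟩

theorem derivAlong_congr (hO : IsOpen O) (h : ∀ z ∈ O, f z = g z) (hz : z ∈ O) :
    derivAlong T f z = derivAlong T g z := by
  have hfg : f =ᶠ[nhds z] g := Filter.eventually_of_mem (hO.mem_nhds hz) h
  rw [derivAlong, derivAlong, hfg.fderiv_eq]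

theorem derivAlong_eq_zero (hO : IsOpen O) (h : ∀ z ∈ O, f z = 0) (hz : z ∈ O) :
    derivAlong T f z = 0 := by
  rw [derivAlong_congr (g := fun _ => 0) hO h hz, derivAlong, fderiv_fun_const]
  rfl

theorem derivAlong_const_comm (hO : IsOpen O) (hf : ContDiffOn 𝕜 ∞ f O) (v w : E) (hz : z ∈ O) :
    derivAlong (fun _ => v) (derivAlong (fun _ => w) f) z =
      derivAlong (fun _ => w) (derivAlong (fun _ => v) f) z := by
  have hfderiv : DifferentiableAt 𝕜 (fderiv 𝕜 f) z :=
    ((hf.fderiv_of_isOpen hO (m := ∞) (by simp)).contDiffAt (hO.mem_nhds hz)).differentiableAt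
      (by simp)
  have hsymm : IsSymmSndFDerivAt 𝕜 f z := (hf.contDiffAt (hO.mem_nhds hz)).isSymmSndFDerivAt (by
    simpa using (WithTop.coe_le_coe.2 le_top : ((2 : ℕ∞) : WithTop ℕ∞) ≤ ∞))
  have hsnd (a b : E) : derivAlong (fun _ => a) (derivAlong (fun _ => b) f) z =
      fderiv 𝕜 (fderiv 𝕜 f) z a b := by
    have : HasFDerivAt (derivAlong (fun _ => b) f) _ z :=
      hfderiv.hasFDerivAt.clm_apply (hasFDerivAt_const b z)
    rw [derivAlong, this.fderiv]
    simp
  rw [hsnd, hsnd, hsymm.eq]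

theorem derivAlong_comp_clm (L : E' →L[𝕜] E) {z : E'} (hf : DifferentiableAt 𝕜 f (L z))
    (T : E' → E') : derivAlong T (f ∘ L) z = fderiv 𝕜 f (L z) (L (T z)) := by
  rw [derivAlong, fderiv_comp z hf L.differentiableAt, L.fderiv]
  rfl

end DerivAlong

section Coordinates

/-- Partial derivative in `y` of a function of `(x, y, u)`. -/
def partialY (f : Pt 𝕜 → 𝕜) (z : Pt 𝕜) : 𝕜 := fderiv 𝕜 f z (0, 1, 0)

/-- The space of the variables `(x, y, u, u_1)`; its last coordinate is called `p` below. -/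
abbrev Pt1 (𝕜 : Type*) := 𝕜 × 𝕜 × 𝕜 × 𝕜

/-- Partial derivative in `x` of a function of `(x, y, u, p)`. -/
def dX (k : Pt1 𝕜 → 𝕜) : Pt1 𝕜 → 𝕜 := derivAlong (fun _ => (1, 0, 0, 0)) k

/-- Partial derivative in `y` of a function of `(x, y, u, p)`. -/
def dY (k : Pt1 𝕜 → 𝕜) : Pt1 𝕜 → 𝕜 := derivAlong (fun _ => (0, 1, 0, 0)) k

/-- Partial derivative in `u` of a function of `(x, y, u, p)`. -/
def dU (k : Pt1 𝕜 → 𝕜) : Pt1 𝕜 → 𝕜 := derivAlong (fun _ => (0, 0, 1, 0)) k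

/-- Partial derivative in `p` of a function of `(x, y, u, p)`. -/
def dP (k : Pt1 𝕜 → 𝕜) : Pt1 𝕜 → 𝕜 := derivAlong (fun _ => (0, 0, 0, 1)) k

/-- The derivation `∂_x + p ∂_u`: the total derivative in `x` without its second-order part
`u_11 ∂_p`. -/
def dH (k : Pt1 𝕜 → 𝕜) : Pt1 𝕜 → 𝕜 := derivAlong (fun q => (1, 0, q.2.2.2, 0)) k

theorem fderiv_pt (f : Pt 𝕜 → 𝕜) (z : Pt 𝕜) (a b c : 𝕜) :
    fderiv 𝕜 f z (a, b, c) = a * partialX f z + b * partialY f z + c * partialU f z := by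
  have : ((a, b, c) : Pt 𝕜) = a • (1, 0, 0) + b • (0, 1, 0) + c • (0, 0, 1) := by simp
  simp only [this, map_add, map_smul, smul_eq_mul, partialX, partialY, partialU]

theorem fderiv_pt1 (k : Pt1 𝕜 → 𝕜) (q : Pt1 𝕜) (a b c d : 𝕜) :
    fderiv 𝕜 k q (a, b, c, d) = a * dX k q + b * dY k q + c * dU k q + d * dP k q := by
  have : ((a, b, c, d) : Pt1 𝕜) =
      a • (1, 0, 0, 0) + b • (0, 1, 0, 0) + c • (0, 0, 1, 0) + d • (0, 0, 0, 1) := by simp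
  simp only [this, map_add, map_smul, smul_eq_mul, dX, dY, dU, dP, derivAlong]

theorem dH_eq (k : Pt1 𝕜 → 𝕜) : dH k = fun q => dX k q + q.2.2.2 * dU k q := by
  funext q
  rw [dH, derivAlong, fderiv_pt1]
  ring

section Pt

variable {U : Set (Pt 𝕜)} {f : Pt 𝕜 → 𝕜} {z : Pt 𝕜}

theorem contDiffOn_partialX (hU : IsOpen U) (hf : ContDiffOn 𝕜 ∞ f U) :
    ContDiffOn 𝕜 ∞ (partialX f) U := contDiffOn_derivAlong hU contDiff_const hf

theorem contDiffOn_partialY (hU : IsOpen U) (hf : ContDiffOn 𝕜 ∞ f U) :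
    ContDiffOn 𝕜 ∞ (partialY f) U := contDiffOn_derivAlong hU contDiff_const hf

theorem contDiffOn_partialU (hU : IsOpen U) (hf : ContDiffOn 𝕜 ∞ f U) :
    ContDiffOn 𝕜 ∞ (partialU f) U := contDiffOn_derivAlong hU contDiff_const hf

theorem hasDerivAlongOn_partialX (hU : IsOpen U) (hf : ContDiffOn 𝕜 ∞ f U) :
    HasDerivAlongOn (fun _ => (1, 0, 0)) f (partialX f) U := hasDerivAlongOn_derivAlong hU hf _

theorem hasDerivAlongOn_partialU (hU : IsOpen U) (hf : ContDiffOn 𝕜 ∞ f U) :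
    HasDerivAlongOn (fun _ => (0, 0, 1)) f (partialU f) U := hasDerivAlongOn_derivAlong hU hf _

theorem partialU_partialX (hU : IsOpen U) (hf : ContDiffOn 𝕜 ∞ f U) (hz : z ∈ U) :
    partialU (partialX f) z = partialX (partialU f) z := derivAlong_const_comm hU hf _ _ hz

theorem partialY_partialX (hU : IsOpen U) (hf : ContDiffOn 𝕜 ∞ f U) (hz : z ∈ U) :
    partialY (partialX f) z = partialX (partialY f) z := derivAlong_const_comm hU hf _ _ hz

theorem partialY_partialU (hU : IsOpen U) (hf : ContDiffOn 𝕜 ∞ f U) (hz : z ∈ U) :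
    partialY (partialU f) z = partialU (partialY f) z := derivAlong_const_comm hU hf _ _ hz

theorem partialU_partialX_partialX (hU : IsOpen U) (hf : ContDiffOn 𝕜 ∞ f U) (hz : z ∈ U) :
    partialU (partialX (partialX f)) z = partialX (partialX (partialU f)) z :=
  (partialU_partialX hU (contDiffOn_partialX hU hf) hz).trans
    (derivAlong_congr (T := fun _ => (1, 0, 0)) hU (fun _ hw => partialU_partialX hU hf hw) hz)

theorem partialY_partialX_partialX (hU : IsOpen U) (hf : ContDiffOn 𝕜 ∞ f U) (hz : z ∈ U) :
    partialY (partialX (partialX f)) z = partialX (partialX (partialY f)) z :=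
  (partialY_partialX hU (contDiffOn_partialX hU hf) hz).trans
    (derivAlong_congr (T := fun _ => (1, 0, 0)) hU (fun _ hw => partialY_partialX hU hf hw) hz)

end Pt

section Pt1

variable {D : Set (Pt1 𝕜)} {k : Pt1 𝕜 → 𝕜} {q : Pt1 𝕜}

theorem contDiffOn_dX (hD : IsOpen D) (hk : ContDiffOn 𝕜 ∞ k D) : ContDiffOn 𝕜 ∞ (dX k) D :=
  contDiffOn_derivAlong hD contDiff_const hk

theorem contDiffOn_dY (hD : IsOpen D) (hk : ContDiffOn 𝕜 ∞ k D) : ContDiffOn 𝕜 ∞ (dY k) D :=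
  contDiffOn_derivAlong hD contDiff_const hk

theorem contDiffOn_dU (hD : IsOpen D) (hk : ContDiffOn 𝕜 ∞ k D) : ContDiffOn 𝕜 ∞ (dU k) D :=
  contDiffOn_derivAlong hD contDiff_const hk

theorem contDiffOn_dP (hD : IsOpen D) (hk : ContDiffOn 𝕜 ∞ k D) : ContDiffOn 𝕜 ∞ (dP k) D :=
  contDiffOn_derivAlong hD contDiff_const hk

theorem hasDerivAlongOn_dP (hD : IsOpen D) (hk : ContDiffOn 𝕜 ∞ k D) :
    HasDerivAlongOn (fun _ => (0, 0, 0, 1)) k (dP k) D := hasDerivAlongOn_derivAlong hD hk _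

theorem contDiffOn_dH (hD : IsOpen D) (hk : ContDiffOn 𝕜 ∞ k D) : ContDiffOn 𝕜 ∞ (dH k) D :=
  contDiffOn_derivAlong hD (by fun_prop) hk

theorem hasDerivAlongOn_p (v : Pt1 𝕜) (D : Set (Pt1 𝕜)) :
    HasDerivAlongOn (fun _ => v) (fun q : Pt1 𝕜 => q.2.2.2) (fun _ => v.2.2.2) D := fun q _ => by
  have h := ((ContinuousLinearMap.snd 𝕜 𝕜 𝕜).comp ((ContinuousLinearMap.snd 𝕜 𝕜 (𝕜 × 𝕜)).comp
    (ContinuousLinearMap.snd 𝕜 𝕜 _))).hasFDerivAt (x := q)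
  exact ⟨h.differentiableAt, congrArg (· v) h.fderiv⟩

theorem hasDerivAlongOn_dH (hD : IsOpen D) (hk : ContDiffOn 𝕜 ∞ k D) (v : Pt1 𝕜) :
    HasDerivAlongOn (fun _ => v) (dH k)
      (fun q => dH (derivAlong (fun _ => v) k) q + v.2.2.2 * dU k q) D := by
  rw [dH_eq k]
  refine ((hasDerivAlongOn_derivAlong hD (contDiffOn_dX hD hk) _).add
    ((hasDerivAlongOn_p v D).mul
      (hasDerivAlongOn_derivAlong hD (contDiffOn_dU hD hk) _))).congr_deriv fun q hq => ?_
  have hX : derivAlong (fun _ => v) (dX k) q = dX (derivAlong (fun _ => v) k) q :=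
    derivAlong_const_comm hD hk _ _ hq
  have hU : derivAlong (fun _ => v) (dU k) q = dU (derivAlong (fun _ => v) k) q :=
    derivAlong_const_comm hD hk _ _ hq
  rw [dH_eq, hX, hU]
  ring

theorem dU_dH (hD : IsOpen D) (hk : ContDiffOn 𝕜 ∞ k D) (hq : q ∈ D) :
    dU (dH k) q = dH (dU k) q := by
  refine ((hasDerivAlongOn_dH hD hk _).derivAlong_eq hq).trans ?_
  simp only [zero_mul, add_zero]
  rfl

theorem dP_dH (hD : IsOpen D) (hk : ContDiffOn 𝕜 ∞ k D) (hq : q ∈ D) :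
    dP (dH k) q = dH (dP k) q + dU k q := by
  refine ((hasDerivAlongOn_dH hD hk _).derivAlong_eq hq).trans ?_
  simp only [one_mul]
  rfl

end Pt1

end Coordinates

section TotalDerivatives

variable {D : Set (Pt1 𝕜)} {k : Pt1 𝕜 → 𝕜} {j : Jet 𝕜}

/-- `base1` as a continuous linear map. -/
def base1L : Jet 𝕜 →L[𝕜] Pt1 𝕜 :=
  (ContinuousLinearMap.proj Coord.x).prod ((ContinuousLinearMap.proj Coord.y).prod
    ((ContinuousLinearMap.proj Coord.u).prod (ContinuousLinearMap.proj Coord.u1)))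

/-- The total derivative `D_x` of a function of `(x, y, u, u_1)`. -/
def totalX (k : Pt1 𝕜 → 𝕜) (j : Jet 𝕜) : 𝕜 := dH k (base1 j) + j .u11 * dP k (base1 j)

/-- The total derivative `D_y` of a function of `(x, y, u, u_1)`. -/
def totalY (k : Pt1 𝕜 → 𝕜) (j : Jet 𝕜) : 𝕜 :=
  dY k (base1 j) + j .u2 * dU k (base1 j) + j .u12 * dP k (base1 j)

theorem isOpen_preimage_base1 (hD : IsOpen D) : IsOpen (base1 ⁻¹' D : Set (Jet 𝕜)) :=
  hD.preimage base1L.continuous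

theorem hasDerivAlongOn_coord (T : Jet 𝕜 → Jet 𝕜) (c : Coord) (O : Set (Jet 𝕜)) :
    HasDerivAlongOn T (fun j => j c) (fun j => T j c) O := fun j _ => by
  have h := (ContinuousLinearMap.proj (R := 𝕜) (φ := fun _ : Coord => 𝕜) c).hasFDerivAt (x := j)
  exact ⟨h.differentiableAt, congrArg (· (T j)) h.fderiv⟩

theorem coe_base1L : ⇑(base1L : Jet 𝕜 →L[𝕜] Pt1 𝕜) = base1 := rfl

theorem hasDerivAlongOn_comp_base1 (hD : IsOpen D) (hk : ContDiffOn 𝕜 ∞ k D)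
    (T : Jet 𝕜 → Jet 𝕜) :
    HasDerivAlongOn T (fun j => k (base1 j)) (fun j => T j .x * dX k (base1 j) +
      T j .y * dY k (base1 j) + T j .u * dU k (base1 j) + T j .u1 * dP k (base1 j))
      (base1 ⁻¹' D) := fun j hj => by
  have hkj : DifferentiableAt 𝕜 k (base1L j) := differentiableAt_of_contDiffOn hD hk hj
  have hd : DifferentiableAt 𝕜 (k ∘ base1L) j := hkj.comp j (base1L (𝕜 := 𝕜)).differentiableAt
  have hchain := derivAlong_comp_clm base1L hkj T
  rw [coe_base1L] at hd hchain
  refine ⟨hd, hchain.trans ?_⟩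
  rw [base1, fderiv_pt1]
  rfl

theorem hasDerivAlongOn_totalX (hD : IsOpen D) (hk : ContDiffOn 𝕜 ∞ k D) :
    HasDerivAlongOn dirX (fun j => k (base1 j)) (totalX k) (base1 ⁻¹' D) :=
  (hasDerivAlongOn_comp_base1 hD hk dirX).congr_deriv fun j _ => by
    simp only [totalX, dH_eq, dirX, base1]
    ring

theorem hasDerivAlongOn_totalY (hD : IsOpen D) (hk : ContDiffOn 𝕜 ∞ k D) :
    HasDerivAlongOn dirY (fun j => k (base1 j)) (totalY k) (base1 ⁻¹' D) :=
  (hasDerivAlongOn_comp_base1 hD hk dirY).congr_deriv fun j _ => by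
    simp only [totalY, dirY]
    ring

end TotalDerivatives

section Prolongation

/-- The projection `(x, y, u, p) ↦ (x, y, u)`. -/
def proj : Pt1 𝕜 →L[𝕜] Pt 𝕜 :=
  (ContinuousLinearMap.id 𝕜 𝕜).prodMap
    ((ContinuousLinearMap.id 𝕜 𝕜).prodMap (ContinuousLinearMap.fst 𝕜 𝕜 𝕜))

/-- The component `ξ` as a function of `(x, y, u, p)`. -/
def xi1 (V : Pt 𝕜 → Pt 𝕜) (q : Pt1 𝕜) : 𝕜 := xi V (proj q)

/-- The component `τ` as a function of `(x, y, u, p)`. -/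
def tau1 (V : Pt 𝕜 → Pt 𝕜) (q : Pt1 𝕜) : 𝕜 := tau V (proj q)

/-- The component `φ` as a function of `(x, y, u, p)`. -/
def phi1 (V : Pt 𝕜 → Pt 𝕜) (q : Pt1 𝕜) : 𝕜 := phi V (proj q)

section PullBack

variable {U : Set (Pt 𝕜)} {f : Pt 𝕜 → 𝕜} {q : Pt1 𝕜}

theorem isOpen_preimage_proj (hU : IsOpen U) : IsOpen (proj ⁻¹' U : Set (Pt1 𝕜)) :=
  hU.preimage proj.continuous

theorem contDiffOn_comp_proj (hf : ContDiffOn 𝕜 ∞ f U) :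
    ContDiffOn 𝕜 ∞ (fun q => f (proj q)) (proj ⁻¹' U) :=
  hf.comp (proj (𝕜 := 𝕜)).contDiff.contDiffOn fun _ hq => hq

theorem derivAlong_comp_proj (hU : IsOpen U) (hf : ContDiffOn 𝕜 ∞ f U) (hq : proj q ∈ U)
    (v : Pt1 𝕜) :
    derivAlong (fun _ => v) (fun q => f (proj q)) q = derivAlong (fun _ => proj v) f (proj q) :=
  derivAlong_comp_clm (proj (𝕜 := 𝕜)) (differentiableAt_of_contDiffOn hU hf hq) _

theorem dX_comp_proj (hU : IsOpen U) (hf : ContDiffOn 𝕜 ∞ f U) (hq : proj q ∈ U) :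
    dX (fun q => f (proj q)) q = partialX f (proj q) := derivAlong_comp_proj hU hf hq _

theorem dY_comp_proj (hU : IsOpen U) (hf : ContDiffOn 𝕜 ∞ f U) (hq : proj q ∈ U) :
    dY (fun q => f (proj q)) q = partialY f (proj q) := derivAlong_comp_proj hU hf hq _

theorem dU_comp_proj (hU : IsOpen U) (hf : ContDiffOn 𝕜 ∞ f U) (hq : proj q ∈ U) :
    dU (fun q => f (proj q)) q = partialU f (proj q) := derivAlong_comp_proj hU hf hq _

theorem dP_comp_proj (hU : IsOpen U) (hf : ContDiffOn 𝕜 ∞ f U) (hq : proj q ∈ U) :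
    dP (fun q => f (proj q)) q = 0 :=
  (derivAlong_comp_proj hU hf hq _).trans (map_zero (fderiv 𝕜 f (proj q)))

end PullBack

variable {D : Set (Pt1 𝕜)} {k : Pt1 𝕜 → 𝕜}

/-- The second total `x`-derivative of a function `k` of `(x, y, u)`, regarded as a function of
`(x, y, u, p)`. -/
def totalXX (k : Pt1 𝕜 → 𝕜) (j : Jet 𝕜) : 𝕜 := dH (dH k) (base1 j) + j .u11 * dU k (base1 j)

/-- The third total `x`-derivative of a function `k` of `(x, y, u)`, regarded as a function of
`(x, y, u, p)`. -/
def totalXXX (k : Pt1 𝕜 → 𝕜) (j : Jet 𝕜) : 𝕜 :=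
  dH (dH (dH k)) (base1 j) + 3 * j .u11 * dH (dU k) (base1 j) + j .u111 * dU k (base1 j)

section DPEqZero

variable {D : Set (Pt1 𝕜)} {k : Pt1 𝕜 → 𝕜} (hD : IsOpen D) (hk : ContDiffOn 𝕜 ∞ k D)
  (hkP : ∀ q ∈ D, dP k q = 0)

include hD hk hkP

theorem hasDerivAlongOn_of_dP_eq_zero :
    HasDerivAlongOn dirX (fun j => k (base1 j)) (fun j => dH k (base1 j)) (base1 ⁻¹' D) :=
  (hasDerivAlongOn_totalX hD hk).congr_deriv fun j hj => by
    simp only [totalX, hkP _ hj, mul_zero, add_zero]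

theorem dP_dH_of_dP_eq_zero {q : Pt1 𝕜} (hq : q ∈ D) : dP (dH k) q = dU k q := by
  rw [dP_dH hD hk hq]
  exact (congrArg (· + _) (derivAlong_eq_zero hD hkP hq)).trans (zero_add _)

theorem dP_dU_of_dP_eq_zero {q : Pt1 𝕜} (hq : q ∈ D) : dP (dU k) q = 0 :=
  (derivAlong_const_comm hD hk _ _ hq).trans (derivAlong_eq_zero hD hkP hq)

theorem dP_dH_dH_of_dP_eq_zero {q : Pt1 𝕜} (hq : q ∈ D) :
    dP (dH (dH k)) q = 2 * dH (dU k) q := by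
  have hH : dH (dP (dH k)) q = dH (dU k) q :=
    derivAlong_congr hD (fun _ hw => dP_dH_of_dP_eq_zero hD hk hkP hw) hq
  rw [dP_dH hD (contDiffOn_dH hD hk) hq, hH, dU_dH hD hk hq]
  ring

theorem hasDerivAlongOn_dH_of_dP_eq_zero :
    HasDerivAlongOn dirX (fun j => dH k (base1 j)) (totalXX k) (base1 ⁻¹' D) :=
  (hasDerivAlongOn_totalX hD (contDiffOn_dH hD hk)).congr_deriv fun j hj => by
    rw [totalX, totalXX, dP_dH_of_dP_eq_zero hD hk hkP hj]

theorem hasDerivAlongOn_totalXX :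
    HasDerivAlongOn dirX (totalXX k) (totalXXX k) (base1 ⁻¹' D) := by
  refine ((hasDerivAlongOn_totalX hD (contDiffOn_dH hD (contDiffOn_dH hD hk))).add
    ((hasDerivAlongOn_coord dirX .u11 _).mul
      (hasDerivAlongOn_of_dP_eq_zero hD (contDiffOn_dU hD hk)
        fun q hq => dP_dU_of_dP_eq_zero hD hk hkP hq))).congr_deriv fun j hj => ?_
  simp only [totalX, totalXXX, dP_dH_dH_of_dP_eq_zero hD hk hkP hj, dirX]
  ring

end DPEqZero

variable {U : Set (Pt 𝕜)} {V : Pt 𝕜 → Pt 𝕜} {j : Jet 𝕜}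

theorem contDiffOn_xi1 (hV : ContDiffOn 𝕜 ∞ V U) : ContDiffOn 𝕜 ∞ (xi1 V) (proj ⁻¹' U) :=
  contDiffOn_comp_proj hV.fst

theorem contDiffOn_tau1 (hV : ContDiffOn 𝕜 ∞ V U) : ContDiffOn 𝕜 ∞ (tau1 V) (proj ⁻¹' U) :=
  contDiffOn_comp_proj hV.snd.fst

theorem contDiffOn_phi1 (hV : ContDiffOn 𝕜 ∞ V U) : ContDiffOn 𝕜 ∞ (phi1 V) (proj ⁻¹' U) :=
  contDiffOn_comp_proj hV.snd.snd

theorem prolStep_eq {O : Set (Jet 𝕜)} {T : Jet 𝕜 → Jet 𝕜} {f f' ξ' τ' : Jet 𝕜 → 𝕜}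
    (hf : HasDerivAlongOn T f f' O) (hξ : HasDerivAlongOn T (fun i => xi1 V (base1 i)) ξ' O)
    (hτ : HasDerivAlongOn T (fun i => tau1 V (base1 i)) τ' O) (c1 c2 : Coord) (hj : j ∈ O) :
    prolStep T V f c1 c2 j = f' j - j c1 * ξ' j - j c2 * τ' j := by
  rw [← hf.derivAlong_eq hj, ← hξ.derivAlong_eq hj, ← hτ.derivAlong_eq hj]
  rfl

section

variable (hU : IsOpen U) (hV : ContDiffOn 𝕜 ∞ V U)

include hU hV

theorem phiX_eq (hj : base j ∈ U) : phiX V j =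
    dH (phi1 V) (base1 j) - j .u1 * dH (xi1 V) (base1 j) - j .u2 * dH (tau1 V) (base1 j) := by
  have hD := isOpen_preimage_proj hU
  exact prolStep_eq
    (hasDerivAlongOn_of_dP_eq_zero hD (contDiffOn_phi1 hV) fun _ => dP_comp_proj hU hV.snd.snd)
    (hasDerivAlongOn_of_dP_eq_zero hD (contDiffOn_xi1 hV) fun _ => dP_comp_proj hU hV.fst)
    (hasDerivAlongOn_of_dP_eq_zero hD (contDiffOn_tau1 hV) fun _ => dP_comp_proj hU hV.snd.fst)
    _ _ hj

theorem phiY_eq (hj : base j ∈ U) : phiY V j =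
    (dY (phi1 V) (base1 j) + j .u2 * dU (phi1 V) (base1 j))
      - j .u1 * (dY (xi1 V) (base1 j) + j .u2 * dU (xi1 V) (base1 j))
      - j .u2 * (dY (tau1 V) (base1 j) + j .u2 * dU (tau1 V) (base1 j)) := by
  have hD := isOpen_preimage_proj hU
  have hφP : dP (phi1 V) (base1 j) = 0 := dP_comp_proj hU hV.snd.snd hj
  have hξP : dP (xi1 V) (base1 j) = 0 := dP_comp_proj hU hV.fst hj
  have hτP : dP (tau1 V) (base1 j) = 0 := dP_comp_proj hU hV.snd.fst hj
  refine (prolStep_eq (hasDerivAlongOn_totalY hD (contDiffOn_phi1 hV))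
    (hasDerivAlongOn_totalY hD (contDiffOn_xi1 hV))
    (hasDerivAlongOn_totalY hD (contDiffOn_tau1 hV)) _ _ hj).trans ?_
  simp only [totalY, hφP, hξP, hτP]
  ring

theorem phiXX_eq (hj : base j ∈ U) : phiXX V j =
    totalXX (phi1 V) j - j .u1 * totalXX (xi1 V) j - 2 * j .u11 * dH (xi1 V) (base1 j)
      - j .u2 * totalXX (tau1 V) j - 2 * j .u12 * dH (tau1 V) (base1 j) := by
  have hD := isOpen_preimage_proj hU
  have hξ := contDiffOn_xi1 hV
  have hτ := contDiffOn_tau1 hV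
  have hξP : ∀ q ∈ proj ⁻¹' U, dP (xi1 V) q = 0 := fun _ => dP_comp_proj hU hV.fst
  have hτP : ∀ q ∈ proj ⁻¹' U, dP (tau1 V) q = 0 := fun _ => dP_comp_proj hU hV.snd.fst
  have hφP : ∀ q ∈ proj ⁻¹' U, dP (phi1 V) q = 0 := fun _ => dP_comp_proj hU hV.snd.snd
  have hphiX := (((hasDerivAlongOn_dH_of_dP_eq_zero hD (contDiffOn_phi1 hV) hφP).sub
    ((hasDerivAlongOn_coord dirX .u1 _).mul (hasDerivAlongOn_dH_of_dP_eq_zero hD hξ hξP))).sub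
    ((hasDerivAlongOn_coord dirX .u2 _).mul (hasDerivAlongOn_dH_of_dP_eq_zero hD hτ hτP))).congr
    (isOpen_preimage_base1 hD) fun _ => phiX_eq hU hV
  refine (prolStep_eq hphiX (hasDerivAlongOn_of_dP_eq_zero hD hξ hξP)
    (hasDerivAlongOn_of_dP_eq_zero hD hτ hτP) _ _ hj).trans ?_
  simp only [dirX]
  ring

theorem phiXXX_eq (hj : base j ∈ U) : phiXXX V j =
    totalXXX (phi1 V) j - j .u1 * totalXXX (xi1 V) j - 3 * j .u11 * totalXX (xi1 V) j
      - 3 * j .u111 * dH (xi1 V) (base1 j) - j .u2 * totalXXX (tau1 V) j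
      - 3 * j .u12 * totalXX (tau1 V) j - 3 * j .u112 * dH (tau1 V) (base1 j) := by
  have hD := isOpen_preimage_proj hU
  have hξ := contDiffOn_xi1 hV
  have hτ := contDiffOn_tau1 hV
  have hξP : ∀ q ∈ proj ⁻¹' U, dP (xi1 V) q = 0 := fun _ => dP_comp_proj hU hV.fst
  have hτP : ∀ q ∈ proj ⁻¹' U, dP (tau1 V) q = 0 := fun _ => dP_comp_proj hU hV.snd.fst
  have hφP : ∀ q ∈ proj ⁻¹' U, dP (phi1 V) q = 0 := fun _ => dP_comp_proj hU hV.snd.snd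
  have coord (c : Coord) := hasDerivAlongOn_coord (𝕜 := 𝕜) dirX c (base1 ⁻¹' (proj ⁻¹' U))
  have two := HasDerivAlongOn.const (T := dirX) (O := base1 ⁻¹' (proj ⁻¹' U)) (2 : 𝕜)
  have hphiXX := (((((hasDerivAlongOn_totalXX hD (contDiffOn_phi1 hV) hφP).sub
    ((coord .u1).mul (hasDerivAlongOn_totalXX hD hξ hξP))).sub
    ((two.mul (coord .u11)).mul (hasDerivAlongOn_dH_of_dP_eq_zero hD hξ hξP))).sub
    ((coord .u2).mul (hasDerivAlongOn_totalXX hD hτ hτP))).sub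
    ((two.mul (coord .u12)).mul (hasDerivAlongOn_dH_of_dP_eq_zero hD hτ hτP))).congr
    (isOpen_preimage_base1 hD) fun _ => phiXX_eq hU hV
  refine (prolStep_eq hphiXX (hasDerivAlongOn_of_dP_eq_zero hD hξ hξP)
    (hasDerivAlongOn_of_dP_eq_zero hD hτ hτP) _ _ hj).trans ?_
  simp only [dirX]
  ring

end

end Prolongation

section SolvedEquation

variable {D : Set (Pt1 𝕜)} {F : Pt1 𝕜 → 𝕜} {j : Jet 𝕜}

/-- The equation `u_2 = F(x, y, u, u_1)`, as a function on the jet space. -/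
def solved (F : Pt1 𝕜 → 𝕜) (j : Jet 𝕜) : 𝕜 := j .u2 - F (base1 j)

section

variable (hD : IsOpen D) (hF : ContDiffOn 𝕜 ∞ F D)

include hD hF

theorem hasDerivAlongOn_solved_dirX :
    HasDerivAlongOn dirX (solved F) (fun j => j .u12 - totalX F j) (base1 ⁻¹' D) :=
  (hasDerivAlongOn_coord dirX .u2 _).sub (hasDerivAlongOn_totalX hD hF)

theorem hasDerivAlongOn_solved_dirY :
    HasDerivAlongOn dirY (solved F) (fun j => j .u22 - totalY F j) (base1 ⁻¹' D) :=
  (hasDerivAlongOn_coord dirY .u2 _).sub (hasDerivAlongOn_totalY hD hF)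

theorem along_dirX_dirX_solved (hj : base1 j ∈ D) : along dirX (along dirX (solved F)) j =
    j .u112 - (totalX (dH F) j + (j .u111 * dP F (base1 j) + j .u11 * totalX (dP F) j)) :=
  (((hasDerivAlongOn_coord dirX .u12 _).sub
    ((hasDerivAlongOn_totalX hD (contDiffOn_dH hD hF)).add
      ((hasDerivAlongOn_coord dirX .u11 _).mul
        (hasDerivAlongOn_totalX hD (contDiffOn_dP hD hF))))).congr (isOpen_preimage_base1 hD)
    fun _ hi => (hasDerivAlongOn_solved_dirX hD hF).derivAlong_eq hi).derivAlong_eq hj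

theorem along_dirX_dirY_solved (hj : base1 j ∈ D) : along dirX (along dirY (solved F)) j =
    j .u122 - (totalX (dY F) j + (j .u12 * dU F (base1 j) + j .u2 * totalX (dU F) j)
      + (j .u112 * dP F (base1 j) + j .u12 * totalX (dP F) j)) :=
  (((hasDerivAlongOn_coord dirX .u22 _).sub
    (((hasDerivAlongOn_totalX hD (contDiffOn_dY hD hF)).add
      ((hasDerivAlongOn_coord dirX .u2 _).mul
        (hasDerivAlongOn_totalX hD (contDiffOn_dU hD hF)))).add
      ((hasDerivAlongOn_coord dirX .u12 _).mul
        (hasDerivAlongOn_totalX hD (contDiffOn_dP hD hF))))).congr (isOpen_preimage_base1 hD)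
    fun _ hi => (hasDerivAlongOn_solved_dirY hD hF).derivAlong_eq hi).derivAlong_eq hj

theorem along_dirY_dirY_solved (hj : base1 j ∈ D) : along dirY (along dirY (solved F)) j =
    j .u222 - (totalY (dY F) j + (j .u22 * dU F (base1 j) + j .u2 * totalY (dU F) j)
      + (j .u122 * dP F (base1 j) + j .u12 * totalY (dP F) j)) :=
  (((hasDerivAlongOn_coord dirY .u22 _).sub
    (((hasDerivAlongOn_totalY hD (contDiffOn_dY hD hF)).add
      ((hasDerivAlongOn_coord dirY .u2 _).mul
        (hasDerivAlongOn_totalY hD (contDiffOn_dU hD hF)))).add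
      ((hasDerivAlongOn_coord dirY .u12 _).mul
        (hasDerivAlongOn_totalY hD (contDiffOn_dP hD hF))))).congr (isOpen_preimage_base1 hD)
    fun _ hi => (hasDerivAlongOn_solved_dirY hD hF).derivAlong_eq hi).derivAlong_eq hj

theorem exists_jet_solved {q : Pt1 𝕜} (hq : q ∈ D) (r g : 𝕜) :
    ∃ j : Jet 𝕜, base1 j = q ∧ j .u11 = r ∧ j .u111 = g ∧ solved F j = 0 ∧
      along dirX (solved F) j = 0 ∧ along dirY (solved F) j = 0 ∧
      along dirX (along dirX (solved F)) j = 0 ∧ along dirX (along dirY (solved F)) j = 0 ∧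
      along dirY (along dirY (solved F)) j = 0 := by
  let totX (k : Pt1 𝕜 → 𝕜) : 𝕜 := dH k q + r * dP k q
  let v12 := totX F
  let totY (k : Pt1 𝕜 → 𝕜) : 𝕜 := dY k q + F q * dU k q + v12 * dP k q
  let v22 := totY F
  let v112 := totX (dH F) + (g * dP F q + r * totX (dP F))
  let v122 := totX (dY F) + (v12 * dU F q + F q * totX (dU F)) +
    (v112 * dP F q + v12 * totX (dP F))
  let v222 := totY (dY F) + (v22 * dU F q + F q * totY (dU F)) +
    (v122 * dP F q + v12 * totY (dP F))
  let j : Jet 𝕜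
    | .x => q.1 | .y => q.2.1 | .u => q.2.2.1
    | .u1 => q.2.2.2 | .u2 => F q
    | .u11 => r | .u12 => v12 | .u22 => v22
    | .u111 => g | .u112 => v112 | .u122 => v122 | .u222 => v222
  exact ⟨j, rfl, rfl, rfl, sub_self (F q),
    ((hasDerivAlongOn_solved_dirX hD hF).derivAlong_eq (z := j) hq).trans (sub_self v12),
    ((hasDerivAlongOn_solved_dirY hD hF).derivAlong_eq (z := j) hq).trans (sub_self v22),
    (along_dirX_dirX_solved (j := j) hD hF hq).trans (sub_self v112),
    (along_dirX_dirY_solved (j := j) hD hF hq).trans (sub_self v122),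
    (along_dirY_dirY_solved (j := j) hD hF hq).trans (sub_self v222)⟩

end

end SolvedEquation

namespace System

/-- The domain in `(x, y, u, p)`-space over which both equations are defined. -/
def dom (S : System 𝕜) : Set (Pt1 𝕜) := {q | proj q ∈ S.U ∧ q ∈ S.W}

/-- The right-hand side `F` of the first equation, as a function of `(x, y, u, p)`. -/
def rhs (S : System 𝕜) (q : Pt1 𝕜) : 𝕜 :=
  S.F1 (proj q) * q.2.2.2 + S.F2 (proj q) * q.2.2.2 ^ 2 + S.F3 q * q.2.2.2 ^ 3

/-- The system with smooth data: `U` and `W` are open, `W` contains the zero section over `U`, and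
the coefficients are smooth (holomorphic if `𝕜 = ℂ`). -/
structure IsSmooth (S : System 𝕜) : Prop where
  isOpen_U : IsOpen S.U
  isOpen_W : IsOpen S.W
  zero_mem_W : ∀ x y u : 𝕜, (x, y, u) ∈ S.U → (x, y, u, 0) ∈ S.W
  contDiffOn_F1 : ContDiffOn 𝕜 ∞ S.F1 S.U
  contDiffOn_F2 : ContDiffOn 𝕜 ∞ S.F2 S.U
  contDiffOn_F3 : ContDiffOn 𝕜 ∞ S.F3 S.W
  contDiffOn_G : ContDiffOn 𝕜 ∞ S.G S.W

variable {S : System 𝕜} {q : Pt1 𝕜}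

theorem IsSmooth.isOpen_dom (hS : S.IsSmooth) : IsOpen S.dom :=
  (isOpen_preimage_proj hS.isOpen_U).inter hS.isOpen_W

theorem IsSmooth.contDiffOn_G_dom (hS : S.IsSmooth) : ContDiffOn 𝕜 ∞ S.G S.dom :=
  hS.contDiffOn_G.mono fun _ hq => hq.2

theorem contDiffOn_comp_proj_dom {f : Pt 𝕜 → 𝕜} (hf : ContDiffOn 𝕜 ∞ f S.U) :
    ContDiffOn 𝕜 ∞ (fun q => f (proj q)) S.dom :=
  (contDiffOn_comp_proj hf).mono fun _ hq => hq.1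

theorem IsSmooth.contDiffOn_rhs (hS : S.IsSmooth) : ContDiffOn 𝕜 ∞ S.rhs S.dom := by
  have hp : ContDiffOn 𝕜 ∞ (fun q : Pt1 𝕜 => q.2.2.2) S.dom := by fun_prop
  exact (((contDiffOn_comp_proj_dom hS.contDiffOn_F1).mul hp).add
    ((contDiffOn_comp_proj_dom hS.contDiffOn_F2).mul (hp.pow 2))).add
    ((hS.contDiffOn_F3.mono fun _ hq => hq.2).mul (hp.pow 3))

theorem IsSmooth.exists_mem_variety (hS : S.IsSmooth) (hq : q ∈ S.dom) (r : 𝕜) :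
    ∃ j ∈ S.variety, base1 j = q ∧ j .u11 = r := by
  obtain ⟨j, hbase, hr, hg, h⟩ := exists_jet_solved hS.isOpen_dom hS.contDiffOn_rhs hq r (S.G q)
  subst hbase
  obtain ⟨h0, hX, hY, hXX, hXY, hYY⟩ := h
  exact ⟨j, ⟨hq.1, hq.2, h0, hX, hY, hXX, hXY, hYY, sub_eq_zero.2 hg⟩, rfl, hr⟩

section Variety

variable {j : Jet 𝕜}

theorem base1_mem_dom (hj : j ∈ S.variety) : base1 j ∈ S.dom := ⟨hj.1, hj.2.1⟩

theorem u2_eq (hj : j ∈ S.variety) : j .u2 = S.rhs (base1 j) := sub_eq_zero.1 hj.2.2.1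

theorem u111_eq (hj : j ∈ S.variety) : j .u111 = S.G (base1 j) :=
  sub_eq_zero.1 hj.2.2.2.2.2.2.2.2

theorem IsSmooth.u12_eq (hS : S.IsSmooth) (hj : j ∈ S.variety) : j .u12 = totalX S.rhs j :=
  sub_eq_zero.1 (((hasDerivAlongOn_solved_dirX hS.isOpen_dom hS.contDiffOn_rhs).derivAlong_eq
    (base1_mem_dom hj)).symm.trans hj.2.2.2.1)

theorem IsSmooth.u112_eq (hS : S.IsSmooth) (hj : j ∈ S.variety) :
    j .u112 = totalX (dH S.rhs) j +
      (j .u111 * dP S.rhs (base1 j) + j .u11 * totalX (dP S.rhs) j) :=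
  sub_eq_zero.1 ((along_dirX_dirX_solved hS.isOpen_dom hS.contDiffOn_rhs
    (base1_mem_dom hj)).symm.trans hj.2.2.2.2.2.1)

end Variety

end System

section DeterminingEquations

/-- The action of the first prolongation of `V` on a function `k` of `(x, y, u, p)`, after
`u_2` has been replaced by `F`. -/
def prolong1 (V : Pt 𝕜 → Pt 𝕜) (F k : Pt1 𝕜 → 𝕜) (q : Pt1 𝕜) : 𝕜 :=
  xi1 V q * dX k q + tau1 V q * dY k q + phi1 V q * dU k q +
    (dH (phi1 V) q - q.2.2.2 * dH (xi1 V) q - F q * dH (tau1 V) q) * dP k q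

namespace System

variable {S : System 𝕜} {V : Pt 𝕜 → Pt 𝕜} {q : Pt1 𝕜} {j : Jet 𝕜}

/-- The part without `u_11` of the second determining equation. -/
def coeffZero (S : System 𝕜) (V : Pt 𝕜 → Pt 𝕜) (q : Pt1 𝕜) : 𝕜 :=
  dH (dH (dH (phi1 V))) q + S.G q * dU (phi1 V) q
    - q.2.2.2 * (dH (dH (dH (xi1 V))) q + S.G q * dU (xi1 V) q)
    - 3 * S.G q * dH (xi1 V) q
    - S.rhs q * (dH (dH (dH (tau1 V))) q + S.G q * dU (tau1 V) q)
    - 3 * dH S.rhs q * dH (dH (tau1 V)) q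
    - 3 * (dH (dH S.rhs) q + S.G q * dP S.rhs q) * dH (tau1 V) q
    - prolong1 V S.rhs S.G q

/-- One third of the coefficient of `u_11` in the second determining equation. -/
def coeffOne (S : System 𝕜) (V : Pt 𝕜 → Pt 𝕜) (q : Pt1 𝕜) : 𝕜 :=
  dH (dU (phi1 V)) q - q.2.2.2 * dH (dU (xi1 V)) q - dH (dH (xi1 V)) q
    - S.rhs q * dH (dU (tau1 V)) q - dP S.rhs q * dH (dH (tau1 V)) q
    - dH S.rhs q * dU (tau1 V) q - (2 * dH (dP S.rhs) q + dU S.rhs q) * dH (tau1 V) q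

/-- Minus one third of the coefficient of `u_11²` in the second determining equation. -/
def coeffTwo (S : System 𝕜) (V : Pt 𝕜 → Pt 𝕜) (q : Pt1 𝕜) : 𝕜 :=
  dU (xi1 V) q + dP S.rhs q * dU (tau1 V) q + dP (dP S.rhs) q * dH (tau1 V) q

section

variable (hS : S.IsSmooth) (hV : S.IsSymmetry V)

include hS hV

theorem prolong1_eq (hj : j ∈ S.variety) (k : Pt1 𝕜 → 𝕜) :
    prolong V j .x * dX k (base1 j) + prolong V j .y * dY k (base1 j) +
      prolong V j .u * dU k (base1 j) + prolong V j .u1 * dP k (base1 j) =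
      prolong1 V S.rhs k (base1 j) := by
  have hX : prolong V j .u1 = dH (phi1 V) (base1 j) - j .u1 * dH (xi1 V) (base1 j)
      - S.rhs (base1 j) * dH (tau1 V) (base1 j) := by
    rw [← u2_eq hj]
    exact phiX_eq hS.isOpen_U hV.1 hj.1
  rw [hX]
  rfl

theorem phiY_eq_prolong1 (hj : j ∈ S.variety) :
    phiY V j = prolong1 V S.rhs S.rhs (base1 j) := by
  have hderiv := ((hasDerivAlongOn_coord (prolong V) .u2 _).sub (hasDerivAlongOn_comp_base1
    hS.isOpen_dom hS.contDiffOn_rhs (prolong V))).derivAlong_eq (base1_mem_dom hj)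
  rw [prolong1_eq hS hV hj] at hderiv
  exact sub_eq_zero.1 (hderiv.symm.trans (hV.2 j hj).1)

theorem phiXXX_eq_prolong1 (hj : j ∈ S.variety) :
    phiXXX V j = prolong1 V S.rhs S.G (base1 j) := by
  have hderiv := ((hasDerivAlongOn_coord (prolong V) .u111 _).sub (hasDerivAlongOn_comp_base1
    hS.isOpen_dom hS.contDiffOn_G_dom (prolong V))).derivAlong_eq (base1_mem_dom hj)
  rw [prolong1_eq hS hV hj] at hderiv
  exact sub_eq_zero.1 (hderiv.symm.trans (hV.2 j hj).2)

theorem first_determining_eq (hq : q ∈ S.dom) :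
    dY (phi1 V) q + S.rhs q * dU (phi1 V) q
      - q.2.2.2 * (dY (xi1 V) q + S.rhs q * dU (xi1 V) q)
      - S.rhs q * (dY (tau1 V) q + S.rhs q * dU (tau1 V) q) = prolong1 V S.rhs S.rhs q := by
  obtain ⟨j, hj, rfl, -⟩ := hS.exists_mem_variety hq 0
  rw [← phiY_eq_prolong1 hS hV hj, phiY_eq hS.isOpen_U hV.1 hj.1, u2_eq hj]
  rfl

theorem second_determining_eq (hq : q ∈ S.dom) (r : 𝕜) :
    S.coeffZero V q + 3 * S.coeffOne V q * r - 3 * S.coeffTwo V q * r ^ 2 = 0 := by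
  obtain ⟨j, hj, rfl, rfl⟩ := hS.exists_mem_variety hq r
  have h := (phiXXX_eq hS.isOpen_U hV.1 hj.1).symm.trans (phiXXX_eq_prolong1 hS hV hj)
  have hdP : dP (dH S.rhs) (base1 j) = dH (dP S.rhs) (base1 j) + dU S.rhs (base1 j) :=
    dP_dH hS.isOpen_dom hS.contDiffOn_rhs hq
  have hp : (base1 j).2.2.2 = j .u1 := rfl
  simp only [totalXXX, totalXX, hS.u112_eq hj, hS.u12_eq hj, u111_eq hj, u2_eq hj, totalX,
    hdP] at h
  simp only [coeffZero, coeffOne, coeffTwo, hp]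
  linear_combination h

theorem coeffs_eq_zero (hq : q ∈ S.dom) :
    S.coeffZero V q = 0 ∧ S.coeffOne V q = 0 ∧ S.coeffTwo V q = 0 := by
  have h0 := second_determining_eq hS hV hq 0
  have h1 := second_determining_eq hS hV hq 1
  have hneg := second_determining_eq hS hV hq (-1)
  refine ⟨?_, ?_, ?_⟩
  · linear_combination h0
  · linear_combination (1 / 6 : 𝕜) * (h1 - hneg)
  · linear_combination (1 / 3 : 𝕜) * h0 - (1 / 6 : 𝕜) * (h1 + hneg)

end

end System

end DeterminingEquations

section InSpan

variable {E E' : Type*} [NormedAddCommGroup E] [NormedSpace 𝕜 E]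
  [NormedAddCommGroup E'] [NormedSpace 𝕜 E'] {ι ι' : Type*} [Fintype ι] [Fintype ι']
  {O : Set E} {O' : Set E'} {T : E → E} {w : ι → E → 𝕜} {w' : ι' → E → 𝕜} {a f f' g : E → 𝕜}

/-- On `O`, the function `f` is a linear combination of the functions `w i` with coefficients that
are smooth on `O`. -/
def InSpan (O : Set E) (w : ι → E → 𝕜) (f : E → 𝕜) : Prop :=
  ∃ c : ι → E → 𝕜, (∀ i, ContDiffOn 𝕜 ∞ (c i) O) ∧ ∀ z ∈ O, f z = ∑ i, c i z * w i z

namespace InSpan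

theorem of_index (O : Set E) (w : ι → E → 𝕜) (i : ι) : InSpan O w (w i) := by
  classical
  exact ⟨fun k _ => if k = i then 1 else 0, fun _ => contDiffOn_const, fun z _ => by simp⟩

theorem zero (O : Set E) (w : ι → E → 𝕜) : InSpan O w fun _ => 0 :=
  ⟨fun _ _ => 0, fun _ => contDiffOn_const, fun z _ => by simp⟩

theorem add (hf : InSpan O w f) (hg : InSpan O w g) : InSpan O w fun z => f z + g z := by
  obtain ⟨c, hc, hfc⟩ := hf
  obtain ⟨d, hd, hgd⟩ := hg
  refine ⟨fun i z => c i z + d i z, fun i => (hc i).add (hd i), fun z hz => ?_⟩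
  simp only [hfc z hz, hgd z hz, add_mul, Finset.sum_add_distrib]

theorem mul (ha : ContDiffOn 𝕜 ∞ a O) (hf : InSpan O w f) : InSpan O w fun z => a z * f z := by
  obtain ⟨c, hc, hfc⟩ := hf
  refine ⟨fun i z => a z * c i z, fun i => ha.mul (hc i), fun z hz => ?_⟩
  simp only [hfc z hz, Finset.mul_sum, mul_assoc]

theorem const_mul (b : 𝕜) (hf : InSpan O w f) : InSpan O w fun z => b * f z :=
  hf.mul contDiffOn_const

theorem congr (hf : InSpan O w f) (h : ∀ z ∈ O, g z = f z) : InSpan O w g := by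
  obtain ⟨c, hc, hfc⟩ := hf
  exact ⟨c, hc, fun z hz => (h z hz).trans (hfc z hz)⟩

theorem sub (hf : InSpan O w f) (hg : InSpan O w g) : InSpan O w fun z => f z - g z :=
  (hf.add (hg.const_mul (-1))).congr fun z _ => by ring

theorem of_mul_ne_zero (ha : ContDiffOn 𝕜 ∞ a O) (ha0 : ∀ z ∈ O, a z ≠ 0)
    (hf : InSpan O w fun z => a z * f z) : InSpan O w f :=
  (hf.mul (ha.inv ha0)).congr fun z hz => (inv_mul_cancel_left₀ (ha0 z hz) (f z)).symm

theorem sum {g : ι' → E → 𝕜} (hg : ∀ i, InSpan O w (g i)) : InSpan O w fun z => ∑ i, g i z := by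
  choose c hc hgc using hg
  refine ⟨fun k z => ∑ i, c i k z, fun k => ContDiffOn.sum fun i _ => hc i k, fun z hz => ?_⟩
  simp only [Finset.sum_mul]
  rw [Finset.sum_comm]
  exact Finset.sum_congr rfl fun i _ => hgc i z hz

theorem trans (hf : InSpan O w f) (hw : ∀ i, InSpan O w' (w i)) : InSpan O w' f := by
  obtain ⟨c, hc, hfc⟩ := hf
  exact (sum fun i => (hw i).mul (hc i)).congr hfc

theorem comp {L : E' → E} (hf : InSpan O w f) (hL : ContDiff 𝕜 ∞ L) (hOO' : Set.MapsTo L O' O) :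
    InSpan O' (fun i z => w i (L z)) fun z => f (L z) := by
  obtain ⟨c, hc, hfc⟩ := hf
  exact ⟨fun i z => c i (L z), fun i => (hc i).comp hL.contDiffOn hOO',
    fun z hz => hfc (L z) (hOO' hz)⟩

theorem deriv (hO : IsOpen O) (hT : ContDiff 𝕜 ∞ T) (hf : InSpan O w f)
    (hff' : HasDerivAlongOn T f f' O) (hw : ∀ i, ContDiffOn 𝕜 ∞ (w i) O)
    (hww' : ∀ i, InSpan O w' (w i)) (hTw : ∀ i, InSpan O w' (derivAlong T (w i))) :
    InSpan O w' f' := by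
  obtain ⟨c, hc, hfc⟩ := hf
  have hprod (i : ι) := (hasDerivAlongOn_derivAlong hO (hc i) T).mul
    (hasDerivAlongOn_derivAlong hO (hw i) T)
  refine (sum fun i => ((hww' i).mul (contDiffOn_derivAlong hO hT (hc i))).add
    ((hTw i).mul (hc i))).congr fun z hz => ?_
  rw [← hff'.derivAlong_eq hz, derivAlong_congr hO hfc hz, derivAlong,
    fderiv_fun_sum fun i _ => (hprod i z hz).1, sum_apply]
  exact Finset.sum_congr rfl fun i _ => (hprod i).derivAlong_eq hz

end InSpan

end InSpan

section TaylorAtZero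

/-- The zero section `(x, y, u) ↦ (x, y, u, 0)`. -/
def lift : Pt 𝕜 →L[𝕜] Pt1 𝕜 :=
  (ContinuousLinearMap.id 𝕜 𝕜).prodMap
    ((ContinuousLinearMap.id 𝕜 𝕜).prodMap (ContinuousLinearMap.inl 𝕜 𝕜 𝕜))

variable {U : Set (Pt 𝕜)} {D : Set (Pt1 𝕜)} {k k' : Pt1 𝕜 → 𝕜} {a a' b b' f : Pt 𝕜 → 𝕜}

theorem InSpan.comp_lift {ι : Type*} [Fintype ι] {w : ι → Pt 𝕜 → 𝕜}
    (hk : InSpan D (fun i q => w i (proj q)) k) (hUD : Set.MapsTo lift U D) :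
    InSpan U w fun z => k (lift z) :=
  hk.comp (lift (𝕜 := 𝕜)).contDiff hUD

theorem derivAlong_comp_lift (hD : IsOpen D) (hk : ContDiffOn 𝕜 ∞ k D) {z : Pt 𝕜}
    (hz : lift z ∈ D) (v : Pt 𝕜) :
    derivAlong (fun _ => v) (fun z => k (lift z)) z = derivAlong (fun _ => lift v) k (lift z) :=
  derivAlong_comp_clm (lift (𝕜 := 𝕜)) (differentiableAt_of_contDiffOn hD hk hz) _

/-- `D` is an open neighbourhood, lying over the open set `U`, of the zero section over `U`. -/
structure IsZeroSectionNhd (U : Set (Pt 𝕜)) (D : Set (Pt1 𝕜)) : Prop where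
  isOpen_base : IsOpen U
  isOpen : IsOpen D
  mapsTo_lift : Set.MapsTo lift U D
  mapsTo_proj : Set.MapsTo proj D U

theorem IsZeroSectionNhd.contDiffOn_comp_proj (h : IsZeroSectionNhd U D)
    (hf : ContDiffOn 𝕜 ∞ f U) : ContDiffOn 𝕜 ∞ (fun q => f (proj q)) D :=
  (LieSymmetry.contDiffOn_comp_proj hf).mono h.mapsTo_proj

/-- `k` is smooth on `D`, and over the points of `U` its expansion in powers of `p` begins with
`a + b p`. -/
structure HasTaylorAtZero (U : Set (Pt 𝕜)) (D : Set (Pt1 𝕜)) (k : Pt1 𝕜 → 𝕜)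
    (a b : Pt 𝕜 → 𝕜) : Prop where
  contDiffOn : ContDiffOn 𝕜 ∞ k D
  apply_lift : ∀ z ∈ U, k (lift z) = a z
  dP_lift : ∀ z ∈ U, dP k (lift z) = b z

namespace HasTaylorAtZero

theorem congr (h : IsZeroSectionNhd U D) (hk : HasTaylorAtZero U D k a b)
    (hkk' : ∀ q ∈ D, k' q = k q) : HasTaylorAtZero U D k' a b :=
  ⟨hk.contDiffOn.congr hkk', fun z hz => (hkk' _ (h.mapsTo_lift hz)).trans (hk.apply_lift z hz),
    fun z hz => (derivAlong_congr h.isOpen hkk' (h.mapsTo_lift hz)).trans (hk.dP_lift z hz)⟩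

theorem congr_coeffs (hk : HasTaylorAtZero U D k a b) (ha : ∀ z ∈ U, a' z = a z)
    (hb : ∀ z ∈ U, b' z = b z) : HasTaylorAtZero U D k a' b' :=
  ⟨hk.contDiffOn, fun z hz => (hk.apply_lift z hz).trans (ha z hz).symm,
    fun z hz => (hk.dP_lift z hz).trans (hb z hz).symm⟩

theorem p : HasTaylorAtZero U D (fun q => q.2.2.2) (fun _ => 0) (fun _ => 1) :=
  ⟨by fun_prop, fun _ _ => rfl,
    fun _ _ => (hasDerivAlongOn_p _ Set.univ).derivAlong_eq (Set.mem_univ _)⟩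

theorem comp_proj (h : IsZeroSectionNhd U D) (hf : ContDiffOn 𝕜 ∞ f U) :
    HasTaylorAtZero U D (fun q => f (proj q)) f (fun _ => 0) :=
  ⟨h.contDiffOn_comp_proj hf, fun _ _ => rfl, fun _ hz => dP_comp_proj h.isOpen_base hf hz⟩

theorem add (h : IsZeroSectionNhd U D) (hk : HasTaylorAtZero U D k a b)
    (hk' : HasTaylorAtZero U D k' a' b') :
    HasTaylorAtZero U D (fun q => k q + k' q) (fun z => a z + a' z) (fun z => b z + b' z) :=
  ⟨hk.contDiffOn.add hk'.contDiffOn,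
    fun z hz => congrArg₂ _ (hk.apply_lift z hz) (hk'.apply_lift z hz),
    fun z hz => (((hasDerivAlongOn_dP h.isOpen hk.contDiffOn).add
      (hasDerivAlongOn_dP h.isOpen hk'.contDiffOn)).derivAlong_eq
        (h.mapsTo_lift hz)).trans (congrArg₂ _ (hk.dP_lift z hz) (hk'.dP_lift z hz))⟩

theorem sub (h : IsZeroSectionNhd U D) (hk : HasTaylorAtZero U D k a b)
    (hk' : HasTaylorAtZero U D k' a' b') :
    HasTaylorAtZero U D (fun q => k q - k' q) (fun z => a z - a' z) (fun z => b z - b' z) :=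
  ⟨hk.contDiffOn.sub hk'.contDiffOn,
    fun z hz => congrArg₂ _ (hk.apply_lift z hz) (hk'.apply_lift z hz),
    fun z hz => (((hasDerivAlongOn_dP h.isOpen hk.contDiffOn).sub
      (hasDerivAlongOn_dP h.isOpen hk'.contDiffOn)).derivAlong_eq
        (h.mapsTo_lift hz)).trans (congrArg₂ _ (hk.dP_lift z hz) (hk'.dP_lift z hz))⟩

theorem mul (h : IsZeroSectionNhd U D) (hk : HasTaylorAtZero U D k a b)
    (hk' : HasTaylorAtZero U D k' a' b') :
    HasTaylorAtZero U D (fun q => k q * k' q) (fun z => a z * a' z)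
      (fun z => b z * a' z + a z * b' z) := by
  refine ⟨hk.contDiffOn.mul hk'.contDiffOn,
    fun z hz => congrArg₂ _ (hk.apply_lift z hz) (hk'.apply_lift z hz), fun z hz => ?_⟩
  rw [← hk.apply_lift z hz, ← hk'.apply_lift z hz, ← hk.dP_lift z hz, ← hk'.dP_lift z hz]
  exact ((hasDerivAlongOn_dP h.isOpen hk.contDiffOn).mul
    (hasDerivAlongOn_dP h.isOpen hk'.contDiffOn)).derivAlong_eq (h.mapsTo_lift hz)

theorem dP (h : IsZeroSectionNhd U D) (hk : HasTaylorAtZero U D k a b) :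
    HasTaylorAtZero U D (dP k) b (fun z => dP (dP k) (lift z)) :=
  ⟨contDiffOn_dP h.isOpen hk.contDiffOn, hk.dP_lift, fun _ _ => rfl⟩

theorem dH (h : IsZeroSectionNhd U D) (hk : HasTaylorAtZero U D k a b) :
    HasTaylorAtZero U D (dH k) (partialX a) (fun z => partialX b z + partialU a z) := by
  have slice {k a} (hk : ContDiffOn 𝕜 ∞ k D) (hka : ∀ z ∈ U, k (lift z) = a z) (v : Pt 𝕜)
      {z : Pt 𝕜} (hz : z ∈ U) :
      derivAlong (fun _ => lift v) k (lift z) = derivAlong (fun _ => v) a z :=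
    (derivAlong_comp_lift h.isOpen hk (h.mapsTo_lift hz) v).symm.trans
      (derivAlong_congr h.isOpen_base hka hz)
  refine ⟨contDiffOn_dH h.isOpen hk.contDiffOn,
    fun z hz => slice hk.contDiffOn hk.apply_lift (1, 0, 0) hz, fun z hz => ?_⟩
  rw [dP_dH h.isOpen hk.contDiffOn (h.mapsTo_lift hz)]
  exact congrArg₂ _
    (slice (contDiffOn_dP h.isOpen hk.contDiffOn) hk.dP_lift (1, 0, 0) hz)
    (slice hk.contDiffOn hk.apply_lift (0, 0, 1) hz)

theorem dP_p_mul (h : IsZeroSectionNhd U D) (hk : HasTaylorAtZero U D k a b) :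
    HasTaylorAtZero U D (LieSymmetry.dP fun q => q.2.2.2 * k q) a (fun z => 2 * b z) :=
  ((hk.add h (p.mul h (hk.dP h))).congr h fun q hq =>
    (((hasDerivAlongOn_p _ D).mul
      (hasDerivAlongOn_dP h.isOpen hk.contDiffOn)).derivAlong_eq hq).trans
        (congrArg (· + _) (one_mul (k q)))).congr_coeffs (fun _ _ => by ring) fun _ _ => by ring

theorem coeffs_eq_zero (h : IsZeroSectionNhd U D) (hk : HasTaylorAtZero U D k a b)
    (hk0 : ∀ q ∈ D, k q = 0) : (∀ z ∈ U, a z = 0) ∧ ∀ z ∈ U, b z = 0 :=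
  ⟨fun z hz => (hk.apply_lift z hz).symm.trans (hk0 _ (h.mapsTo_lift hz)),
    fun z hz => (hk.dP_lift z hz).symm.trans
      (derivAlong_eq_zero h.isOpen hk0 (h.mapsTo_lift hz))⟩

end HasTaylorAtZero

section PullBack

variable (h : IsZeroSectionNhd U D) (hf : ContDiffOn 𝕜 ∞ f U)

include h hf

theorem hasTaylorAtZero_dY_comp_proj :
    HasTaylorAtZero U D (dY fun q => f (proj q)) (partialY f) (fun _ => 0) :=
  (HasTaylorAtZero.comp_proj h (contDiffOn_partialY h.isOpen_base hf)).congr h fun _ hq =>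
    dY_comp_proj h.isOpen_base hf (h.mapsTo_proj hq)

theorem hasTaylorAtZero_dU_comp_proj :
    HasTaylorAtZero U D (dU fun q => f (proj q)) (partialU f) (fun _ => 0) :=
  (HasTaylorAtZero.comp_proj h (contDiffOn_partialU h.isOpen_base hf)).congr h fun _ hq =>
    dU_comp_proj h.isOpen_base hf (h.mapsTo_proj hq)

theorem hasTaylorAtZero_dH_comp_proj :
    HasTaylorAtZero U D (dH fun q => f (proj q)) (partialX f) (partialU f) :=
  ((HasTaylorAtZero.comp_proj h hf).dH h).congr_coeffs (fun _ _ => rfl) fun z hz => by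
    have hzero : partialX (fun _ => (0 : 𝕜)) z = 0 :=
      derivAlong_eq_zero (T := fun _ => (1, 0, 0)) h.isOpen_base (fun _ _ => rfl) hz
    rw [hzero, zero_add]

theorem hasTaylorAtZero_dH_dU_comp_proj :
    HasTaylorAtZero U D (dH (dU fun q => f (proj q))) (partialX (partialU f))
      (partialU (partialU f)) :=
  (hasTaylorAtZero_dH_comp_proj h (contDiffOn_partialU h.isOpen_base hf)).congr h fun _ hq =>
    derivAlong_congr h.isOpen
      (fun _ hw => dU_comp_proj h.isOpen_base hf (h.mapsTo_proj hw)) hq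

theorem hasTaylorAtZero_dH_dH_comp_proj :
    HasTaylorAtZero U D (dH (dH fun q => f (proj q))) (partialX (partialX f))
      (fun z => 2 * partialX (partialU f) z) :=
  ((hasTaylorAtZero_dH_comp_proj h hf).dH h).congr_coeffs (fun _ _ => rfl) fun z hz => by
    rw [partialU_partialX h.isOpen_base hf hz, two_mul]

theorem hasTaylorAtZero_dH_dH_dH_comp_proj :
    HasTaylorAtZero U D (dH (dH (dH fun q => f (proj q)))) (partialX (partialX (partialX f)))
      (fun z => 3 * partialX (partialX (partialU f)) z) :=
  ((hasTaylorAtZero_dH_dH_comp_proj h hf).dH h).congr_coeffs (fun _ _ => rfl) fun z hz => by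
    have hXU := contDiffOn_partialX h.isOpen_base (contDiffOn_partialU h.isOpen_base hf)
    have htwo : partialX (fun z => 2 * partialX (partialU f) z) z =
        0 * partialX (partialU f) z + 2 * partialX (partialX (partialU f)) z :=
      ((HasDerivAlongOn.const 2).mul
        (hasDerivAlongOn_partialX h.isOpen_base hXU)).derivAlong_eq hz
    rw [htwo, partialU_partialX_partialX h.isOpen_base hf hz]
    ring

theorem hasDerivAlongOn_dP_dY_comp_proj :
    HasDerivAlongOn (fun _ => (0, 0, 0, 1)) (dY fun q => f (proj q)) (fun _ => 0) D :=
  (hasDerivAlongOn_dP h.isOpen (hasTaylorAtZero_dY_comp_proj h hf).contDiffOn).congr_deriv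
    fun _ hq =>
      ((derivAlong_congr h.isOpen
        (fun _ hw => dY_comp_proj h.isOpen_base hf (h.mapsTo_proj hw)) hq).trans
        (dP_comp_proj h.isOpen_base (contDiffOn_partialY h.isOpen_base hf)
          (h.mapsTo_proj hq))).symm

theorem dH_comp_proj {q : Pt1 𝕜} (hq : q ∈ D) :
    dH (fun q => f (proj q)) q = partialX f (proj q) + q.2.2.2 * partialU f (proj q) := by
  simp only [dH_eq]
  rw [dX_comp_proj h.isOpen_base hf (h.mapsTo_proj hq),
    dU_comp_proj h.isOpen_base hf (h.mapsTo_proj hq)]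

end PullBack

namespace InSpan

variable {ι ι' : Type*} [Fintype ι] [Fintype ι'] {w : ι → Pt 𝕜 → 𝕜} {w' : ι' → Pt 𝕜 → 𝕜}

theorem comp_proj (h : IsZeroSectionNhd U D) (hf : InSpan U w f) :
    InSpan D (fun i q => w i (proj q)) fun q => f (proj q) :=
  hf.comp (proj (𝕜 := 𝕜)).contDiff h.mapsTo_proj

theorem dU_comp_proj (h : IsZeroSectionNhd U D) (hf : ContDiffOn 𝕜 ∞ f U)
    (hfU : InSpan U w (partialU f)) :
    InSpan D (fun i q => w i (proj q)) (dU fun q => f (proj q)) :=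
  (hfU.comp_proj h).congr fun _ hq =>
    LieSymmetry.dU_comp_proj h.isOpen_base hf (h.mapsTo_proj hq)

theorem dH_comp_proj (h : IsZeroSectionNhd U D) (hf : ContDiffOn 𝕜 ∞ f U)
    (hfX : InSpan U w (partialX f)) (hfU : InSpan U w (partialU f)) :
    InSpan D (fun i q => w i (proj q)) (dH fun q => f (proj q)) :=
  ((hfX.comp_proj h).add ((hfU.comp_proj h).mul (HasTaylorAtZero.p (U := U)).contDiffOn)).congr
    fun _ hq => LieSymmetry.dH_comp_proj h hf hq

theorem dH (h : IsZeroSectionNhd U D) (hk : InSpan D (fun i q => w i (proj q)) k)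
    (hkD : ContDiffOn 𝕜 ∞ k D) (hw : ∀ i, ContDiffOn 𝕜 ∞ (w i) U)
    (hww' : ∀ i, InSpan U w' (w i)) (hwX : ∀ i, InSpan U w' (partialX (w i)))
    (hwU : ∀ i, InSpan U w' (partialU (w i))) : InSpan D (fun i q => w' i (proj q)) (dH k) :=
  hk.deriv h.isOpen (by fun_prop) (hasDerivAlongOn_derivAlong h.isOpen hkD _)
    (fun i => h.contDiffOn_comp_proj (hw i)) (fun i => (hww' i).comp_proj h)
    fun i => dH_comp_proj h (hw i) (hwX i) (hwU i)

theorem deriv_p (h : IsZeroSectionNhd U D) (hw : ∀ i, ContDiffOn 𝕜 ∞ (w i) U)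
    (hk : InSpan D (fun i q => w i (proj q)) k)
    (hkk' : HasDerivAlongOn (fun _ => (0, 0, 0, 1)) k k' D) :
    InSpan D (fun i q => w i (proj q)) k' :=
  hk.deriv h.isOpen contDiff_const hkk' (fun i => h.contDiffOn_comp_proj (hw i)) (of_index D _)
    fun i => (zero D _).congr fun _ hq => dP_comp_proj h.isOpen_base (hw i) (h.mapsTo_proj hq)

theorem taylor_zero (h : IsZeroSectionNhd U D) (hk : InSpan D (fun i q => w i (proj q)) k)
    (hab : HasTaylorAtZero U D k a b) : InSpan U w a :=
  (hk.comp_lift h.mapsTo_lift).congr fun z hz => (hab.apply_lift z hz).symm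

theorem taylor_one (h : IsZeroSectionNhd U D) (hw : ∀ i, ContDiffOn 𝕜 ∞ (w i) U)
    (hk : InSpan D (fun i q => w i (proj q)) k) (hab : HasTaylorAtZero U D k a b) :
    InSpan U w b :=
  (hk.deriv_p h hw (hasDerivAlongOn_dP h.isOpen hab.contDiffOn)).taylor_zero h
    (hab.dP h)

end InSpan

end TaylorAtZero

section SpanOfTaylorCoeffs

/-- The Taylor coefficients of order at most one among the initial ones, as functions on `U`. -/
def frame1 (V : Pt 𝕜 → Pt 𝕜) : Fin 7 → Pt 𝕜 → 𝕜 :=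
  ![xi V, tau V, phi V, partialX (xi V), partialX (tau V), partialX (phi V), partialU (phi V)]

/-- The ten initial Taylor coefficients, as functions on `U`. -/
def frame (V : Pt 𝕜 → Pt 𝕜) (i : Fin 10) (z : Pt 𝕜) : 𝕜 := initialTaylorCoeffs V z i

variable {U : Set (Pt 𝕜)} {V : Pt 𝕜 → Pt 𝕜}

theorem contDiffOn_xi (hV : ContDiffOn 𝕜 ∞ V U) : ContDiffOn 𝕜 ∞ (xi V) U := hV.fst

theorem contDiffOn_tau (hV : ContDiffOn 𝕜 ∞ V U) : ContDiffOn 𝕜 ∞ (tau V) U := hV.snd.fst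

theorem contDiffOn_phi (hV : ContDiffOn 𝕜 ∞ V U) : ContDiffOn 𝕜 ∞ (phi V) U := hV.snd.snd

theorem contDiffOn_frame (hU : IsOpen U) (hV : ContDiffOn 𝕜 ∞ V U) (i : Fin 10) :
    ContDiffOn 𝕜 ∞ (frame V i) U := by
  have hξ := contDiffOn_xi hV
  have hτ := contDiffOn_tau hV
  have hφ := contDiffOn_phi hV
  have hX {f : Pt 𝕜 → 𝕜} (hf : ContDiffOn 𝕜 ∞ f U) := contDiffOn_partialX hU hf
  fin_cases i
  exacts [hξ, hτ, hφ, hX hξ, hX hτ, hX hφ, contDiffOn_partialU hU hφ, hX (hX hξ), hX (hX hτ),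
    hX (hX hφ)]

theorem inSpan_frame1 (U : Set (Pt 𝕜)) (V : Pt 𝕜 → Pt 𝕜) (i : Fin 7) :
    InSpan U (frame V) (frame1 V i) := by
  have h (k : Fin 10) := InSpan.of_index U (frame V) k
  fin_cases i
  exacts [h 0, h 1, h 2, h 3, h 4, h 5, h 6]

theorem contDiffOn_frame1 (hU : IsOpen U) (hV : ContDiffOn 𝕜 ∞ V U) (i : Fin 7) :
    ContDiffOn 𝕜 ∞ (frame1 V i) U := by
  have h (k : Fin 10) := contDiffOn_frame hU hV k
  fin_cases i
  exacts [h 0, h 1, h 2, h 3, h 4, h 5, h 6]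

namespace System

variable {S : System 𝕜} {V : Pt 𝕜 → Pt 𝕜}

theorem IsSmooth.isZeroSectionNhd (hS : S.IsSmooth) : IsZeroSectionNhd S.U S.dom :=
  ⟨hS.isOpen_U, hS.isOpen_dom, fun z hz => ⟨hz, hS.zero_mem_W z.1 z.2.1 z.2.2 hz⟩,
    fun _ hq => hq.1⟩

/-- The factor `F1 + F2 p + F3 p²` of the right-hand side `F`. -/
def rhsDivP (S : System 𝕜) (q : Pt1 𝕜) : 𝕜 :=
  S.F1 (proj q) + q.2.2.2 * (S.F2 (proj q) + q.2.2.2 * S.F3 q)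

theorem rhs_eq (S : System 𝕜) : S.rhs = fun q => q.2.2.2 * S.rhsDivP q := by
  funext q
  simp only [rhs, rhsDivP]
  ring

theorem IsSmooth.hasTaylorAtZero_rhsDivP (hS : S.IsSmooth) :
    HasTaylorAtZero S.U S.dom S.rhsDivP S.F1 S.F2 := by
  have h := hS.isZeroSectionNhd
  have hF3 : HasTaylorAtZero S.U S.dom S.F3 (fun z => S.F3 (lift z))
      (fun z => dP S.F3 (lift z)) :=
    ⟨hS.contDiffOn_F3.mono fun _ hq => hq.2, fun _ _ => rfl, fun _ _ => rfl⟩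
  exact ((HasTaylorAtZero.comp_proj h hS.contDiffOn_F1).add h (HasTaylorAtZero.p.mul h
    ((HasTaylorAtZero.comp_proj h hS.contDiffOn_F2).add h (HasTaylorAtZero.p.mul h
      hF3)))).congr_coeffs (fun _ _ => by ring) fun _ _ => by ring

theorem IsSmooth.hasTaylorAtZero_rhs (hS : S.IsSmooth) :
    HasTaylorAtZero S.U S.dom S.rhs (fun _ => 0) S.F1 := by
  rw [rhs_eq]
  exact (HasTaylorAtZero.p.mul hS.isZeroSectionNhd hS.hasTaylorAtZero_rhsDivP).congr_coeffs
    (fun _ _ => by ring) fun _ _ => by ring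

theorem IsSmooth.hasTaylorAtZero_dP_rhs (hS : S.IsSmooth) :
    HasTaylorAtZero S.U S.dom (dP S.rhs) S.F1 (fun z => 2 * S.F2 z) := by
  rw [rhs_eq]
  exact hS.hasTaylorAtZero_rhsDivP.dP_p_mul hS.isZeroSectionNhd

variable (hS : S.IsSmooth) (hV : S.IsSymmetry V)

include hS hV

theorem exists_coeffTwo_relations : ∃ f3 : Pt 𝕜 → 𝕜, ContDiffOn 𝕜 ∞ f3 S.U ∧
    (∀ z ∈ S.U, partialU (xi V) z + S.F1 z * partialU (tau V) z +
      2 * S.F2 z * partialX (tau V) z = 0) ∧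
    ∀ z ∈ S.U, 4 * S.F2 z * partialU (tau V) z + f3 z * partialX (tau V) z = 0 := by
  have h := hS.isZeroSectionNhd
  have hFP := hS.hasTaylorAtZero_dP_rhs
  have hξ := contDiffOn_xi hV.1
  have hτ := contDiffOn_tau hV.1
  obtain ⟨hzero, hone⟩ := (((hasTaylorAtZero_dU_comp_proj h hξ).add h
    (hFP.mul h (hasTaylorAtZero_dU_comp_proj h hτ))).add h
    ((hFP.dP h).mul h (hasTaylorAtZero_dH_comp_proj h hτ))).coeffs_eq_zero h
      fun q hq => (coeffs_eq_zero hS hV hq).2.2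
  refine ⟨_, (contDiffOn_dP h.isOpen ((hFP.dP h).contDiffOn)).comp
    (lift (𝕜 := 𝕜)).contDiff.contDiffOn h.mapsTo_lift, hzero, fun z hz => ?_⟩
  simp only [Function.comp_apply]
  linear_combination hone z hz

theorem partialU_xi_add_eq_zero {z : Pt 𝕜} (hz : z ∈ S.U) :
    partialU (xi V) z + S.F1 z * partialU (tau V) z + 2 * S.F2 z * partialX (tau V) z = 0 := by
  obtain ⟨-, -, h, -⟩ := exists_coeffTwo_relations hS hV
  exact h z hz

variable (hF2 : ∀ z ∈ S.U, S.F2 z ≠ 0)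

include hF2

theorem inSpan_partialU_tau : InSpan S.U (frame1 V) (partialU (tau V)) := by
  obtain ⟨f3, hf3, -, h⟩ := exists_coeffTwo_relations hS hV
  have hτX : InSpan S.U (frame1 V) (partialX (tau V)) := .of_index _ _ 4
  exact .of_mul_ne_zero (a := fun z => 4 * S.F2 z) (contDiffOn_const.mul hS.contDiffOn_F2)
    (fun z hz => mul_ne_zero (OfNat.ofNat_ne_zero 4) (hF2 z hz))
    ((hτX.mul hf3.neg).congr fun z hz => by linear_combination h z hz)

theorem inSpan_partialU_xi : InSpan S.U (frame1 V) (partialU (xi V)) := by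
  have hτX : InSpan S.U (frame1 V) (partialX (tau V)) := .of_index _ _ 4
  exact (((hτX.mul hS.contDiffOn_F2).const_mul (-2)).sub
    ((inSpan_partialU_tau hS hV hF2).mul hS.contDiffOn_F1)).congr fun z hz => by
      linear_combination partialU_xi_add_eq_zero hS hV hz

theorem inSpan_dU_xi1 : InSpan S.dom (fun i q => frame1 V i (proj q)) (dU (xi1 V)) :=
  .dU_comp_proj hS.isZeroSectionNhd (contDiffOn_xi hV.1) (inSpan_partialU_xi hS hV hF2)

theorem inSpan_dU_tau1 : InSpan S.dom (fun i q => frame1 V i (proj q)) (dU (tau1 V)) :=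
  .dU_comp_proj hS.isZeroSectionNhd (contDiffOn_tau hV.1) (inSpan_partialU_tau hS hV hF2)

theorem inSpan_dH_xi1 : InSpan S.dom (fun i q => frame1 V i (proj q)) (dH (xi1 V)) :=
  .dH_comp_proj hS.isZeroSectionNhd (contDiffOn_xi hV.1) (.of_index _ _ 3)
    (inSpan_partialU_xi hS hV hF2)

theorem inSpan_dH_tau1 : InSpan S.dom (fun i q => frame1 V i (proj q)) (dH (tau1 V)) :=
  .dH_comp_proj hS.isZeroSectionNhd (contDiffOn_tau hV.1) (.of_index _ _ 4)
    (inSpan_partialU_tau hS hV hF2)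

omit hF2 in
theorem inSpan_dU_phi1 : InSpan S.dom (fun i q => frame1 V i (proj q)) (dU (phi1 V)) :=
  .dU_comp_proj hS.isZeroSectionNhd (contDiffOn_phi hV.1) (.of_index _ _ 6)

theorem inSpan_prolong1 {k : Pt1 𝕜 → 𝕜} (hk : ContDiffOn 𝕜 ∞ k S.dom) :
    InSpan S.dom (fun i q => frame1 V i (proj q)) (prolong1 V S.rhs k) := by
  have h := hS.isZeroSectionNhd
  have hp : ContDiffOn 𝕜 ∞ (fun q : Pt1 𝕜 => q.2.2.2) S.dom := by fun_prop
  have hkP := contDiffOn_dP h.isOpen hk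
  have comp_proj (i : Fin 7) := (InSpan.of_index S.U (frame1 V) i).comp_proj h
  have hφH : InSpan S.dom (fun i q => frame1 V i (proj q)) (dH (phi1 V)) :=
    .dH_comp_proj h (contDiffOn_phi hV.1) (.of_index _ _ 5) (.of_index _ _ 6)
  exact (((((comp_proj 0).mul (contDiffOn_dX h.isOpen hk)).add
    ((comp_proj 1).mul (contDiffOn_dY h.isOpen hk))).add
    ((comp_proj 2).mul (contDiffOn_dU h.isOpen hk))).add
    (((hφH.sub ((inSpan_dH_xi1 hS hV hF2).mul hp)).sub
      ((inSpan_dH_tau1 hS hV hF2).mul hS.contDiffOn_rhs)).mul hkP)).congr fun q _ => by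
        simp only [prolong1, xi1, tau1, phi1, frame1, Matrix.cons_val]
        ring

theorem inSpan_lead_first :
    InSpan S.dom (fun i q => frame1 V i (proj q))
      fun q => dY (phi1 V) q - q.2.2.2 * dY (xi1 V) q - S.rhs q * dY (tau1 V) q := by
  have hp : ContDiffOn 𝕜 ∞ (fun q : Pt1 𝕜 => q.2.2.2) S.dom := by fun_prop
  have hF := hS.contDiffOn_rhs
  exact ((((inSpan_prolong1 hS hV hF2 hF).sub ((inSpan_dU_phi1 hS hV).mul hF)).add
    ((inSpan_dU_xi1 hS hV hF2).mul (hp.mul hF))).add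
    ((inSpan_dU_tau1 hS hV hF2).mul (hF.mul hF))).congr fun q hq => by
      linear_combination first_determining_eq hS hV hq

theorem inSpan_partialY_phi : InSpan S.U (frame1 V) (partialY (phi V)) := by
  have h := hS.isZeroSectionNhd
  have hY {f : Pt 𝕜 → 𝕜} (hf : ContDiffOn 𝕜 ∞ f S.U) := hasTaylorAtZero_dY_comp_proj h hf
  exact ((inSpan_lead_first hS hV hF2).taylor_zero h
    (((hY (contDiffOn_phi hV.1)).sub h (HasTaylorAtZero.p.mul h (hY (contDiffOn_xi hV.1)))).sub h
      (hS.hasTaylorAtZero_rhs.mul h (hY (contDiffOn_tau hV.1))))).congr fun _ _ => by ring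

theorem inSpan_dP_lead_first :
    InSpan S.dom (fun i q => frame1 V i (proj q))
      fun q => dY (xi1 V) q + dP S.rhs q * dY (tau1 V) q := by
  have h := hS.isZeroSectionNhd
  have hY {f : Pt 𝕜 → 𝕜} (hf : ContDiffOn 𝕜 ∞ f S.U) := hasDerivAlongOn_dP_dY_comp_proj h hf
  have hderiv := (((hY (contDiffOn_phi hV.1)).sub
    ((hasDerivAlongOn_p _ _).mul (hY (contDiffOn_xi hV.1)))).sub
    ((hasDerivAlongOn_dP h.isOpen hS.contDiffOn_rhs).mul (hY (contDiffOn_tau hV.1))))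
  refine (((inSpan_lead_first hS hV hF2).deriv_p h (contDiffOn_frame1 h.isOpen_base hV.1)
    hderiv).const_mul (-1)).congr fun q _ => ?_
  change dY (fun q => xi V (proj q)) q + dP S.rhs q * dY (fun q => tau V (proj q)) q = _
  ring

theorem inSpan_partialY_xi_and_tau :
    InSpan S.U (frame1 V) (partialY (xi V)) ∧ InSpan S.U (frame1 V) (partialY (tau V)) := by
  have h := hS.isZeroSectionNhd
  have hlead := inSpan_dP_lead_first hS hV hF2
  have htaylor := (hasTaylorAtZero_dY_comp_proj h (contDiffOn_xi hV.1)).add h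
    (hS.hasTaylorAtZero_dP_rhs.mul h (hasTaylorAtZero_dY_comp_proj h (contDiffOn_tau hV.1)))
  have hτ : InSpan S.U (frame1 V) (partialY (tau V)) :=
    .of_mul_ne_zero (a := fun z => 2 * S.F2 z) (contDiffOn_const.mul hS.contDiffOn_F2)
      (fun z hz => mul_ne_zero two_ne_zero (hF2 z hz))
      ((hlead.taylor_one h (contDiffOn_frame1 h.isOpen_base hV.1) htaylor).congr
        fun _ _ => by ring)
  exact ⟨((hlead.taylor_zero h htaylor).sub (hτ.mul hS.contDiffOn_F1)).congr fun _ _ => by ring,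
    hτ⟩

end System

end SpanOfTaylorCoeffs

section DerivativesOfFrame

namespace System

variable {S : System 𝕜} {V : Pt 𝕜 → Pt 𝕜} {f f' : Pt 𝕜 → 𝕜} (hS : S.IsSmooth)
  (hV : S.IsSymmetry V) (hF2 : ∀ z ∈ S.U, S.F2 z ≠ 0)

include hS hV hF2

theorem inSpan_partialX_partialU_xi_add :
    InSpan S.U (frame1 V) fun z => partialX (partialU (xi V)) z +
      S.F1 z * partialX (partialU (tau V)) z + 2 * S.F2 z * partialX (partialX (tau V)) z := by
  have hU := hS.isOpen_U
  have D {f : Pt 𝕜 → 𝕜} (hf : ContDiffOn 𝕜 ∞ f S.U) :=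
    hasDerivAlongOn_partialX hU hf
  have hτ := contDiffOn_tau hV.1
  have hF2two : ContDiffOn 𝕜 ∞ (fun z => 2 * S.F2 z) S.U := contDiffOn_const.mul hS.contDiffOn_F2
  have hderiv := ((D (contDiffOn_partialU hU (contDiffOn_xi hV.1))).add
    ((D hS.contDiffOn_F1).mul (D (contDiffOn_partialU hU hτ)))).add
    ((D hF2two).mul (D (contDiffOn_partialX hU hτ)))
  have hτX : InSpan S.U (frame1 V) (partialX (tau V)) := .of_index _ _ 4
  refine ((((inSpan_partialU_tau hS hV hF2).mul
    (contDiffOn_partialX hU hS.contDiffOn_F1)).add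
    (hτX.mul (contDiffOn_partialX hU hF2two))).const_mul (-1)).congr fun z hz => ?_
  have hzero := (hderiv.derivAlong_eq hz).symm.trans
    (derivAlong_eq_zero hU (fun _ => partialU_xi_add_eq_zero hS hV) hz)
  linear_combination hzero

theorem inSpan_coeffOne_lead :
    InSpan S.dom (fun i q => frame1 V i (proj q)) fun q => dH (dU (phi1 V)) q
      - q.2.2.2 * dH (dU (xi1 V)) q - dH (dH (xi1 V)) q - S.rhs q * dH (dU (tau1 V)) q
      - dP S.rhs q * dH (dH (tau1 V)) q := by
  have hD := hS.isOpen_dom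
  have hF := hS.contDiffOn_rhs
  exact (((inSpan_dU_tau1 hS hV hF2).mul (contDiffOn_dH hD hF)).add
    ((inSpan_dH_tau1 hS hV hF2).mul (((contDiffOn_const (c := 2)).mul
      (contDiffOn_dH hD (contDiffOn_dP hD hF))).add (contDiffOn_dU hD hF)))).congr fun q hq => by
    have h := (coeffs_eq_zero hS hV hq).2.1
    rw [coeffOne] at h
    linear_combination h

theorem inSpan_coeffOne_relations :
    InSpan S.U (frame1 V) (fun z => partialX (partialU (phi V)) z
      - partialX (partialX (xi V)) z - S.F1 z * partialX (partialX (tau V)) z) ∧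
    InSpan S.U (frame1 V) fun z => partialU (partialU (phi V)) z
      + 4 * S.F2 z * partialX (partialX (tau V)) z := by
  have h := hS.isZeroSectionNhd
  have hξ := contDiffOn_xi hV.1
  have hτ := contDiffOn_tau hV.1
  have htaylor := ((((hasTaylorAtZero_dH_dU_comp_proj h (contDiffOn_phi hV.1)).sub h
    (HasTaylorAtZero.p.mul h (hasTaylorAtZero_dH_dU_comp_proj h hξ))).sub h
    (hasTaylorAtZero_dH_dH_comp_proj h hξ)).sub h
    (hS.hasTaylorAtZero_rhs.mul h (hasTaylorAtZero_dH_dU_comp_proj h hτ))).sub h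
    (hS.hasTaylorAtZero_dP_rhs.mul h (hasTaylorAtZero_dH_dH_comp_proj h hτ))
  have hlead := inSpan_coeffOne_lead hS hV hF2
  refine ⟨(hlead.taylor_zero h htaylor).congr fun _ _ => by ring, ?_⟩
  exact ((hlead.taylor_one h (contDiffOn_frame1 h.isOpen_base hV.1) htaylor).add
    ((inSpan_partialX_partialU_xi_add hS hV hF2).const_mul 3)).congr fun _ _ => by ring

theorem inSpan_partialX_partialU_phi : InSpan S.U (frame V) (partialX (partialU (phi V))) := by
  have hξXX : InSpan S.U (frame V) (partialX (partialX (xi V))) := .of_index _ _ 7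
  have hτXX : InSpan S.U (frame V) (partialX (partialX (tau V))) := .of_index _ _ 8
  exact ((((inSpan_coeffOne_relations hS hV hF2).1.trans (inSpan_frame1 _ V)).add hξXX).add
    (hτXX.mul hS.contDiffOn_F1)).congr fun _ _ => by ring

theorem inSpan_partialX_frame1 (i : Fin 7) : InSpan S.U (frame V) (partialX (frame1 V i)) := by
  have h (k : Fin 10) := InSpan.of_index S.U (frame V) k
  fin_cases i
  exacts [h 3, h 4, h 5, h 7, h 8, h 9, inSpan_partialX_partialU_phi hS hV hF2]

theorem inSpan_derivX (hf : InSpan S.U (frame1 V) f)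
    (hff' : HasDerivAlongOn (fun _ => (1, 0, 0)) f f' S.U) : InSpan S.U (frame V) f' :=
  hf.deriv hS.isOpen_U contDiff_const hff' (contDiffOn_frame1 hS.isOpen_U hV.1)
    (inSpan_frame1 _ V) (inSpan_partialX_frame1 hS hV hF2)

theorem inSpan_partialX (hf : ContDiffOn 𝕜 ∞ f S.U) (hfw : InSpan S.U (frame1 V) f) :
    InSpan S.U (frame V) (partialX f) :=
  inSpan_derivX hS hV hF2 hfw (hasDerivAlongOn_partialX hS.isOpen_U hf)

theorem inSpan_partialU_partialU_phi : InSpan S.U (frame V) (partialU (partialU (phi V))) := by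
  have hτXX : InSpan S.U (frame V) (partialX (partialX (tau V))) := .of_index _ _ 8
  exact (((inSpan_coeffOne_relations hS hV hF2).2.trans (inSpan_frame1 _ V)).sub
    ((hτXX.mul hS.contDiffOn_F2).const_mul 4)).congr fun _ _ => by ring

theorem inSpan_partialU_frame1 (i : Fin 7) : InSpan S.U (frame V) (partialU (frame1 V i)) := by
  have hU := hS.isOpen_U
  have hξ := contDiffOn_xi hV.1
  have hτ := contDiffOn_tau hV.1
  have hξU := inSpan_partialU_xi hS hV hF2
  have hτU := inSpan_partialU_tau hS hV hF2
  have mixed {f : Pt 𝕜 → 𝕜} (hf : ContDiffOn 𝕜 ∞ f S.U)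
      (hfXU : InSpan S.U (frame V) (partialX (partialU f))) :
      InSpan S.U (frame V) (partialU (partialX f)) :=
    hfXU.congr fun _ hz => partialU_partialX hU hf hz
  fin_cases i
  exacts [hξU.trans (inSpan_frame1 _ V), hτU.trans (inSpan_frame1 _ V), .of_index _ _ 6,
    mixed hξ (inSpan_partialX hS hV hF2 (contDiffOn_partialU hU hξ) hξU),
    mixed hτ (inSpan_partialX hS hV hF2 (contDiffOn_partialU hU hτ) hτU),
    mixed (contDiffOn_phi hV.1) (inSpan_partialX_partialU_phi hS hV hF2),
    inSpan_partialU_partialU_phi hS hV hF2]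

theorem inSpan_derivU (hf : InSpan S.U (frame1 V) f)
    (hff' : HasDerivAlongOn (fun _ => (0, 0, 1)) f f' S.U) : InSpan S.U (frame V) f' :=
  hf.deriv hS.isOpen_U contDiff_const hff' (contDiffOn_frame1 hS.isOpen_U hV.1)
    (inSpan_frame1 _ V) (inSpan_partialU_frame1 hS hV hF2)

theorem inSpan_partialX_partialX_partialX_tau :
    InSpan S.U (frame V) (partialX (partialX (partialX (tau V)))) := by
  have hU := hS.isOpen_U
  have DX {f : Pt 𝕜 → 𝕜} (hf : ContDiffOn 𝕜 ∞ f S.U) := hasDerivAlongOn_partialX hU hf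
  have DU {f : Pt 𝕜 → 𝕜} (hf : ContDiffOn 𝕜 ∞ f S.U) := hasDerivAlongOn_partialU hU hf
  have cX {f : Pt 𝕜 → 𝕜} (hf : ContDiffOn 𝕜 ∞ f S.U) := contDiffOn_partialX hU hf
  have cU {f : Pt 𝕜 → 𝕜} (hf : ContDiffOn 𝕜 ∞ f S.U) := contDiffOn_partialU hU hf
  have hξ := contDiffOn_xi hV.1
  have hτ := contDiffOn_tau hV.1
  have hφ := contDiffOn_phi hV.1
  have hF1 := hS.contDiffOn_F1
  have hcF2 (c : 𝕜) : ContDiffOn 𝕜 ∞ (fun z => c * S.F2 z) S.U :=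
    contDiffOn_const.mul hS.contDiffOn_F2
  have hτXX : InSpan S.U (frame V) (partialX (partialX (tau V))) := .of_index _ _ 8
  have hτXU := inSpan_partialX hS hV hF2 (cU hτ) (inSpan_partialU_tau hS hV hF2)
  have hφUUX := inSpan_derivX hS hV hF2 (inSpan_coeffOne_relations hS hV hF2).2
    ((DX (cU (cU hφ))).add ((DX (hcF2 4)).mul (DX (cX (cX hτ)))))
  have hφXUU := inSpan_derivU hS hV hF2 (inSpan_coeffOne_relations hS hV hF2).1
    (((DU (cX (cU hφ))).sub (DU (cX (cX hξ)))).sub ((DU hF1).mul (DU (cX (cX hτ)))))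
  have hξXUX := inSpan_derivX hS hV hF2 (inSpan_partialX_partialU_xi_add hS hV hF2)
    (((DX (cX (cU hξ))).add ((DX hF1).mul (DX (cX (cU hτ))))).add
      ((DX (hcF2 2)).mul (DX (cX (cX hτ)))))
  refine .of_mul_ne_zero (hcF2 2) (fun z hz => mul_ne_zero two_ne_zero (hF2 z hz))
    (((((hφUUX.sub hφXUU).sub hξXUX).add (hτXX.mul (((cX (hcF2 2)).sub (cX (hcF2 4))).sub
      (cU hF1)))).add (hτXU.mul (cX hF1))).congr fun z hz => ?_)
  rw [partialU_partialX hU (cU hφ) hz, partialU_partialX_partialX hU hξ hz,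
    partialU_partialX_partialX hU hτ hz]
  ring

theorem inSpan_coeffZero_lead :
    InSpan S.dom (fun i q => frame V i (proj q)) fun q => dH (dH (dH (phi1 V))) q
      - q.2.2.2 * dH (dH (dH (xi1 V))) q - S.rhs q * dH (dH (dH (tau1 V))) q := by
  have h := hS.isZeroSectionNhd
  have hD := hS.isOpen_dom
  have hp : ContDiffOn 𝕜 ∞ (fun q : Pt1 𝕜 => q.2.2.2) S.dom := by fun_prop
  have hF := hS.contDiffOn_rhs
  have hFH := contDiffOn_dH hD hF
  have hG := hS.contDiffOn_G_dom
  have lift_frame {k : Pt1 𝕜 → 𝕜} (hk : InSpan S.dom (fun i q => frame1 V i (proj q)) k) :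
      InSpan S.dom (fun i q => frame V i (proj q)) k :=
    hk.trans fun i => (inSpan_frame1 S.U V i).comp_proj h
  have hτHH : InSpan S.dom (fun i q => frame V i (proj q)) (dH (dH (tau1 V))) :=
    (inSpan_dH_tau1 hS hV hF2).dH h (hasTaylorAtZero_dH_comp_proj h
      (contDiffOn_tau hV.1)).contDiffOn (contDiffOn_frame1 hS.isOpen_U hV.1) (inSpan_frame1 _ V)
      (inSpan_partialX_frame1 hS hV hF2) (inSpan_partialU_frame1 hS hV hF2)
  have hlower := ((((inSpan_prolong1 hS hV hF2 hG).sub ((inSpan_dU_phi1 hS hV).mul hG)).add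
    ((inSpan_dU_xi1 hS hV hF2).mul (hp.mul hG))).add
    ((inSpan_dU_tau1 hS hV hF2).mul (hF.mul hG))).add
    ((((inSpan_dH_xi1 hS hV hF2).mul hG).add ((inSpan_dH_tau1 hS hV hF2).mul
      ((contDiffOn_dH hD hFH).add (hG.mul (contDiffOn_dP hD hF))))).const_mul 3)
  refine ((lift_frame hlower).add ((hτHH.mul hFH).const_mul 3)).congr fun q hq => ?_
  have hzero := (coeffs_eq_zero hS hV hq).1
  rw [coeffZero] at hzero
  linear_combination hzero

theorem inSpan_coeffZero_relations :
    InSpan S.U (frame V) (partialX (partialX (partialX (phi V)))) ∧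
    InSpan S.U (frame V) fun z => 3 * partialX (partialX (partialU (phi V))) z
      - partialX (partialX (partialX (xi V))) z
      - S.F1 z * partialX (partialX (partialX (tau V))) z := by
  have h := hS.isZeroSectionNhd
  have htaylor := ((hasTaylorAtZero_dH_dH_dH_comp_proj h (contDiffOn_phi hV.1)).sub h
    (HasTaylorAtZero.p.mul h (hasTaylorAtZero_dH_dH_dH_comp_proj h (contDiffOn_xi hV.1)))).sub h
    (hS.hasTaylorAtZero_rhs.mul h (hasTaylorAtZero_dH_dH_dH_comp_proj h (contDiffOn_tau hV.1)))
  have hlead := inSpan_coeffZero_lead hS hV hF2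
  exact ⟨(hlead.taylor_zero h htaylor).congr fun _ _ => by ring,
    (hlead.taylor_one h (contDiffOn_frame hS.isOpen_U hV.1) htaylor).congr fun _ _ => by ring⟩

theorem inSpan_partialX_partialX_partialX_xi :
    InSpan S.U (frame V) (partialX (partialX (partialX (xi V)))) := by
  have hU := hS.isOpen_U
  have DX {f : Pt 𝕜 → 𝕜} (hf : ContDiffOn 𝕜 ∞ f S.U) := hasDerivAlongOn_partialX hU hf
  have cX {f : Pt 𝕜 → 𝕜} (hf : ContDiffOn 𝕜 ∞ f S.U) := contDiffOn_partialX hU hf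
  have hF1 := hS.contDiffOn_F1
  have hτXX : InSpan S.U (frame V) (partialX (partialX (tau V))) := .of_index _ _ 8
  have hφXUX := inSpan_derivX hS hV hF2 (inSpan_coeffOne_relations hS hV hF2).1
    (((DX (cX (contDiffOn_partialU hU (contDiffOn_phi hV.1)))).sub
      (DX (cX (cX (contDiffOn_xi hV.1))))).sub
      ((DX hF1).mul (DX (cX (cX (contDiffOn_tau hV.1))))))
  exact (((((inSpan_coeffZero_relations hS hV hF2).2.sub (hφXUX.const_mul 3)).sub
    ((hτXX.mul (cX hF1)).const_mul 3)).const_mul (1 / 2)).sub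
    ((inSpan_partialX_partialX_partialX_tau hS hV hF2).mul hF1)).congr fun _ _ => by ring

theorem inSpan_partialX_frame (i : Fin 10) : InSpan S.U (frame V) (partialX (frame V i)) := by
  have h (k : Fin 10) := InSpan.of_index S.U (frame V) k
  fin_cases i
  exacts [h 3, h 4, h 5, h 7, h 8, h 9, inSpan_partialX_partialU_phi hS hV hF2,
    inSpan_partialX_partialX_partialX_xi hS hV hF2,
    inSpan_partialX_partialX_partialX_tau hS hV hF2,
    (inSpan_coeffZero_relations hS hV hF2).1]

theorem inSpan_partialX_partialX (hf : ContDiffOn 𝕜 ∞ f S.U) (hfw : InSpan S.U (frame1 V) f) :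
    InSpan S.U (frame V) (partialX (partialX f)) :=
  (inSpan_partialX hS hV hF2 hf hfw).deriv hS.isOpen_U contDiff_const
    (hasDerivAlongOn_partialX hS.isOpen_U (contDiffOn_partialX hS.isOpen_U hf))
    (contDiffOn_frame hS.isOpen_U hV.1) (.of_index _ _) (inSpan_partialX_frame hS hV hF2)

theorem inSpan_partialU_frame (i : Fin 10) : InSpan S.U (frame V) (partialU (frame V i)) := by
  have hU := hS.isOpen_U
  have h (k : Fin 7) := inSpan_partialU_frame1 hS hV hF2 k
  have mixed {f : Pt 𝕜 → 𝕜} (hf : ContDiffOn 𝕜 ∞ f S.U)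
      (hfU : InSpan S.U (frame1 V) (partialU f)) :
      InSpan S.U (frame V) (partialU (partialX (partialX f))) :=
    (inSpan_partialX_partialX hS hV hF2 (contDiffOn_partialU hU hf) hfU).congr fun _ hz =>
      partialU_partialX_partialX hU hf hz
  fin_cases i
  exacts [h 0, h 1, h 2, h 3, h 4, h 5, h 6,
    mixed (contDiffOn_xi hV.1) (inSpan_partialU_xi hS hV hF2),
    mixed (contDiffOn_tau hV.1) (inSpan_partialU_tau hS hV hF2),
    mixed (contDiffOn_phi hV.1) (.of_index _ _ 6)]

theorem inSpan_partialY_frame (i : Fin 10) : InSpan S.U (frame V) (partialY (frame V i)) := by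
  have hU := hS.isOpen_U
  have hξ := contDiffOn_xi hV.1
  have hτ := contDiffOn_tau hV.1
  have hφ := contDiffOn_phi hV.1
  obtain ⟨hξY, hτY⟩ := inSpan_partialY_xi_and_tau hS hV hF2
  have hφY := inSpan_partialY_phi hS hV hF2
  have one {f : Pt 𝕜 → 𝕜} (hf : ContDiffOn 𝕜 ∞ f S.U)
      (hfY : InSpan S.U (frame1 V) (partialY f)) :
      InSpan S.U (frame V) (partialY (partialX f)) :=
    (inSpan_partialX hS hV hF2 (contDiffOn_partialY hU hf) hfY).congr fun _ hz =>
      partialY_partialX hU hf hz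
  have two {f : Pt 𝕜 → 𝕜} (hf : ContDiffOn 𝕜 ∞ f S.U)
      (hfY : InSpan S.U (frame1 V) (partialY f)) :
      InSpan S.U (frame V) (partialY (partialX (partialX f))) :=
    (inSpan_partialX_partialX hS hV hF2 (contDiffOn_partialY hU hf) hfY).congr fun _ hz =>
      partialY_partialX_partialX hU hf hz
  have hφUY : InSpan S.U (frame V) (partialY (partialU (phi V))) :=
    (inSpan_derivU hS hV hF2 hφY (hasDerivAlongOn_partialU hU (contDiffOn_partialY hU hφ))).congr
      fun _ hz => partialY_partialU hU hφ hz
  fin_cases i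
  exacts [hξY.trans (inSpan_frame1 _ V), hτY.trans (inSpan_frame1 _ V),
    hφY.trans (inSpan_frame1 _ V), one hξ hξY, one hτ hτY, one hφ hφY, hφUY, two hξ hξY,
    two hτ hτY, two hφ hφY]

end System

end DerivativesOfFrame

section Uniqueness

open Asymptotics Filter Topology

section Real

variable {E F : Type*} [NormedAddCommGroup E] [NormedSpace ℝ E] [NormedAddCommGroup F]
  [NormedSpace ℝ F] {w : E → F} {w' : E → E →L[ℝ] F} {U : Set E} {z z₀ : E}

theorem eventually_eq_zero_of_isBigO_hasFDerivAt (hw : ∀ᶠ y in 𝓝 z, HasFDerivAt w (w' y) y)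
    (hO : w' =O[𝓝 z] w) (hz : w z = 0) : ∀ᶠ y in 𝓝 z, w y = 0 := by
  obtain ⟨K, hK⟩ := hO.bound
  obtain ⟨ε, hε, hball⟩ := Metric.eventually_nhds_iff_ball.1 (hw.and hK)
  filter_upwards [Metric.ball_mem_nhds z hε] with y hy
  have hline {t : ℝ} (ht : t ∈ Set.Icc (0 : ℝ) 1) : AffineMap.lineMap z y t ∈ Metric.ball z ε :=
    (convex_ball z ε).lineMap_mem (Metric.mem_ball_self hε) hy ht
  have hderiv {t : ℝ} (ht : t ∈ Set.Icc (0 : ℝ) 1) :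
      HasDerivAt (fun t : ℝ => w (AffineMap.lineMap z y t))
        (w' (AffineMap.lineMap z y t) (y - z)) t :=
    (hball _ (hline ht)).1.comp_hasDerivAt t AffineMap.hasDerivAt_lineMap
  have hbound {t : ℝ} (ht : t ∈ Set.Icc (0 : ℝ) 1) :
      ‖w' (AffineMap.lineMap z y t) (y - z)‖ ≤ K * ‖y - z‖ * ‖w (AffineMap.lineMap z y t)‖ :=
    ((w' _).le_of_opNorm_le (hball _ (hline ht)).2 _).trans_eq (by ring)
  have hzero := eq_zero_of_abs_deriv_le_mul_abs_self_of_eq_zero_right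
    (fun t ht => (hderiv ht).continuousAt.continuousWithinAt)
    (fun t ht => (hderiv (Set.Ico_subset_Icc_self ht)).hasDerivWithinAt) (by simpa using hz)
    (fun t ht => hbound (Set.Ico_subset_Icc_self ht)) 1 (Set.right_mem_Icc.2 zero_le_one)
  simpa using hzero

theorem eqOn_zero_of_isBigO_hasFDerivAt (hUo : IsOpen U) (hU : IsPreconnected U)
    (hw : ∀ z ∈ U, HasFDerivAt w (w' z) z) (hO : ∀ z ∈ U, w' =O[𝓝 z] w) (hz₀ : z₀ ∈ U)
    (h0 : w z₀ = 0) : ∀ z ∈ U, w z = 0 := by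
  have hopen : IsOpen {z | z ∈ U ∧ w z = 0} := by
    refine isOpen_iff_mem_nhds.2 fun z ⟨hz, hwz⟩ => ?_
    have hU_nhds := hUo.eventually_mem hz
    exact hU_nhds.and
      (eventually_eq_zero_of_isBigO_hasFDerivAt (hU_nhds.mono hw) (hO z hz) hwz)
  have hclosed : closure {z | z ∈ U ∧ w z = 0} ∩ U ⊆ {z | z ∈ U ∧ w z = 0} := by
    rintro z ⟨hz, hzU⟩
    refine ⟨hzU, by_contra fun hne => ?_⟩
    obtain ⟨y, hy, -, hwy⟩ :=
      mem_closure_iff_nhds.1 hz _ ((hw z hzU).continuousAt.eventually_ne hne)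
    exact hy hwy
  exact fun z hz => (hU.subset_of_closure_inter_subset hopen ⟨z₀, hz₀, hz₀, h0⟩ hclosed hz).2

end Real

variable {ι : Type*} [Fintype ι]

theorem InSpan.isBigO {E : Type*} [NormedAddCommGroup E] [NormedSpace 𝕜 E] {O : Set E}
    {w : ι → E → 𝕜} {f : E → 𝕜} {z : E} (hO : IsOpen O) (hf : InSpan O w f) (hz : z ∈ O) :
    f =O[𝓝 z] fun y i => w i y := by
  obtain ⟨c, hc, hfc⟩ := hf
  have hterm (i : ι) : (fun y => c i y * w i y) =O[𝓝 z] fun y i => w i y := by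
    have hci : c i =O[𝓝 z] fun _ => (1 : ℝ) :=
      ((hc i).continuousOn.continuousAt (hO.mem_nhds hz)).tendsto.isBigO_one ℝ
    simpa using hci.mul (isBigO_pi.1 (isBigO_refl (fun y i => w i y) (𝓝 z)) i).norm_right
  have hsum : (fun y => ∑ i, c i y * w i y) =O[𝓝 z] fun y i => w i y :=
    IsBigO.fun_sum fun i _ => hterm i
  exact hsum.congr' ((hO.eventually_mem hz).mono fun y hy => (hfc y hy).symm) .rfl

theorem norm_fderiv_le (f : Pt 𝕜 → 𝕜) (z : Pt 𝕜) :
    ‖fderiv 𝕜 f z‖ ≤ ‖partialX f z‖ + ‖partialY f z‖ + ‖partialU f z‖ := by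
  refine ContinuousLinearMap.opNorm_le_bound _ (by positivity) fun ⟨a, b, c⟩ => ?_
  have ha : ‖a‖ ≤ ‖((a, b, c) : Pt 𝕜)‖ := norm_fst_le (a, b, c)
  have hbc : ‖((b, c) : 𝕜 × 𝕜)‖ ≤ ‖((a, b, c) : Pt 𝕜)‖ := norm_snd_le (a, b, c)
  have hb := (norm_fst_le ((b, c) : 𝕜 × 𝕜)).trans hbc
  have hc := (norm_snd_le ((b, c) : 𝕜 × 𝕜)).trans hbc
  rw [fderiv_pt, add_mul, add_mul]
  refine norm_add₃_le.trans ?_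
  simp only [norm_mul, mul_comm ‖partialX f z‖, mul_comm ‖partialY f z‖, mul_comm ‖partialU f z‖]
  gcongr

theorem isBigO_fderiv_of_partials {F : Type*} [NormedAddCommGroup F] {f : Pt 𝕜 → 𝕜}
    {g : Pt 𝕜 → F} {l : Filter (Pt 𝕜)} (hX : partialX f =O[l] g) (hY : partialY f =O[l] g)
    (hU : partialU f =O[l] g) : fderiv 𝕜 f =O[l] g :=
  (IsBigO.of_norm_le (norm_fderiv_le f)).trans
    ((hX.norm_left.add hY.norm_left).add hU.norm_left)

theorem eq_zero_of_inSpan_partials {U : Set (Pt 𝕜)} {w : ι → Pt 𝕜 → 𝕜} {z₀ : Pt 𝕜}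
    (hUo : IsOpen U) (hU : IsPreconnected U) (hw : ∀ i, ContDiffOn 𝕜 ∞ (w i) U)
    (hX : ∀ i, InSpan U w (partialX (w i))) (hY : ∀ i, InSpan U w (partialY (w i)))
    (hU' : ∀ i, InSpan U w (partialU (w i))) (hz₀ : z₀ ∈ U) (h0 : ∀ i, w i z₀ = 0) :
    ∀ z ∈ U, ∀ i, w i z = 0 := by
  have hderiv (z : Pt 𝕜) (hz : z ∈ U) : HasFDerivAt (fun y i => w i y)
      ((ContinuousLinearMap.pi fun i => fderiv 𝕜 (w i) z).restrictScalars ℝ) z :=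
    (hasFDerivAt_pi.2 fun i =>
      (differentiableAt_of_contDiffOn hUo (hw i) hz).hasFDerivAt).restrictScalars ℝ
  have hbigO (z : Pt 𝕜) (hz : z ∈ U) : (fun z =>
      (ContinuousLinearMap.pi fun i => fderiv 𝕜 (w i) z).restrictScalars ℝ) =O[𝓝 z]
        fun y i => w i y := by
    have hpi : (fun z i => fderiv 𝕜 (w i) z) =O[𝓝 z] fun y i => w i y :=
      isBigO_pi.2 fun i => isBigO_fderiv_of_partials ((hX i).isBigO hUo hz)
        ((hY i).isBigO hUo hz) ((hU' i).isBigO hUo hz)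
    refine .trans (.of_norm_le fun y => ?_) hpi.norm_left
    rw [ContinuousLinearMap.norm_restrictScalars]
    exact ContinuousLinearMap.norm_pi_le_of_le (norm_le_pi_norm _) (norm_nonneg _)
  exact fun z hz =>
    congrFun (eqOn_zero_of_isBigO_hasFDerivAt hUo hU hderiv hbigO hz₀ (funext h0) z hz)

end Uniqueness

section InitialTaylorCoeffs

variable {U : Set (Pt 𝕜)} {V V₁ V₂ : Pt 𝕜 → Pt 𝕜} {f f₁ f₂ : Pt 𝕜 → 𝕜} {a b : 𝕜} {z z₀ : Pt 𝕜}

theorem derivAlong_comb (hU : IsOpen U) (hf₁ : ContDiffOn 𝕜 ∞ f₁ U) (hf₂ : ContDiffOn 𝕜 ∞ f₂ U)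
    (hf : ∀ z ∈ U, f z = a * f₁ z + b * f₂ z) (v : Pt 𝕜) (hz : z ∈ U) :
    derivAlong (fun _ => v) f z =
      a * derivAlong (fun _ => v) f₁ z + b * derivAlong (fun _ => v) f₂ z := by
  have hcomb := ((HasDerivAlongOn.const a).mul (hasDerivAlongOn_derivAlong hU hf₁ _)).add
    ((HasDerivAlongOn.const b).mul (hasDerivAlongOn_derivAlong hU hf₂ fun _ => v))
  refine (derivAlong_congr hU hf hz).trans ((hcomb.derivAlong_eq hz).trans ?_)
  ring

theorem initialTaylorCoeffs_comb (hU : IsOpen U) (hV₁ : ContDiffOn 𝕜 ∞ V₁ U)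
    (hV₂ : ContDiffOn 𝕜 ∞ V₂ U) (hV : ∀ z ∈ U, V z = a • V₁ z + b • V₂ z) (hz : z ∈ U) :
    initialTaylorCoeffs V z = a • initialTaylorCoeffs V₁ z + b • initialTaylorCoeffs V₂ z := by
  have X {f f₁ f₂ : Pt 𝕜 → 𝕜} (hf₁ : ContDiffOn 𝕜 ∞ f₁ U) (hf₂ : ContDiffOn 𝕜 ∞ f₂ U)
      (hf : ∀ z ∈ U, f z = a * f₁ z + b * f₂ z) (z : Pt 𝕜) (hz : z ∈ U) :
      partialX f z = a * partialX f₁ z + b * partialX f₂ z :=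
    derivAlong_comb hU hf₁ hf₂ hf (1, 0, 0) hz
  have XX {f f₁ f₂ : Pt 𝕜 → 𝕜} (hf₁ : ContDiffOn 𝕜 ∞ f₁ U) (hf₂ : ContDiffOn 𝕜 ∞ f₂ U)
      (hf : ∀ z ∈ U, f z = a * f₁ z + b * f₂ z) :
      partialX (partialX f) z = a * partialX (partialX f₁) z + b * partialX (partialX f₂) z :=
    X (contDiffOn_partialX hU hf₁) (contDiffOn_partialX hU hf₂) (X hf₁ hf₂ hf) z hz
  have hξ (z : Pt 𝕜) (hz : z ∈ U) : xi V z = a * xi V₁ z + b * xi V₂ z :=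
    congrArg Prod.fst (hV z hz)
  have hτ (z : Pt 𝕜) (hz : z ∈ U) : tau V z = a * tau V₁ z + b * tau V₂ z :=
    congrArg (fun v => v.2.1) (hV z hz)
  have hφ (z : Pt 𝕜) (hz : z ∈ U) : phi V z = a * phi V₁ z + b * phi V₂ z :=
    congrArg (fun v => v.2.2) (hV z hz)
  have hξ₁ := contDiffOn_xi hV₁
  have hξ₂ := contDiffOn_xi hV₂
  have hτ₁ := contDiffOn_tau hV₁
  have hτ₂ := contDiffOn_tau hV₂
  have hφ₁ := contDiffOn_phi hV₁
  have hφ₂ := contDiffOn_phi hV₂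
  funext i
  fin_cases i
  exacts [hξ z hz, hτ z hz, hφ z hz, X hξ₁ hξ₂ hξ z hz, X hτ₁ hτ₂ hτ z hz, X hφ₁ hφ₂ hφ z hz,
    derivAlong_comb hU hφ₁ hφ₂ hφ (0, 0, 1) hz, XX hξ₁ hξ₂ hξ, XX hτ₁ hτ₂ hτ, XX hφ₁ hφ₂ hφ]

namespace System

variable {S : System 𝕜}

theorem IsSymmetry.eq_zero (hV : S.IsSymmetry V) (hS : S.IsSmooth)
    (hF2 : ∀ z ∈ S.U, S.F2 z ≠ 0) (hU : IsPreconnected S.U) (hz₀ : z₀ ∈ S.U)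
    (h0 : initialTaylorCoeffs V z₀ = 0) : ∀ z ∈ S.U, V z = 0 := by
  have hframe := eq_zero_of_inSpan_partials hS.isOpen_U hU (contDiffOn_frame hS.isOpen_U hV.1)
    (inSpan_partialX_frame hS hV hF2) (inSpan_partialY_frame hS hV hF2)
    (inSpan_partialU_frame hS hV hF2) hz₀ (congrFun h0)
  exact fun z hz => Prod.ext (hframe z hz 0) (Prod.ext (hframe z hz 1) (hframe z hz 2))

theorem IsSymmetry.eq_of_initialTaylorCoeffs_eq (hV₁ : S.IsSymmetry V₁) (hV₂ : S.IsSymmetry V₂)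
    (hS : S.IsSmooth) (hF2 : ∀ z ∈ S.U, S.F2 z ≠ 0) (hU : IsPreconnected S.U) (hz₀ : z₀ ∈ S.U)
    (h0 : initialTaylorCoeffs V₁ z₀ = initialTaylorCoeffs V₂ z₀) : ∀ z ∈ S.U, V₁ z = V₂ z := by
  intro z hz
  have hdiff : initialTaylorCoeffs (fun z => (1 : 𝕜) • V₁ z + (-1 : 𝕜) • V₂ z) z₀ = 0 := by
    rw [initialTaylorCoeffs_comb hS.isOpen_U hV₁.1 hV₂.1 (fun _ _ => rfl) hz₀, h0, one_smul,
      neg_one_smul, add_neg_cancel]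
  simpa [add_neg_eq_zero] using
    (hV₁.comb hS.isOpen_U hV₂ 1 (-1)).eq_zero hS hF2 hU hz₀ hdiff z hz

theorem exists_initialTaylorCoeffs_linearMap (S : System 𝕜) (hU : IsOpen S.U) (hz₀ : z₀ ∈ S.U) :
    ∃ L : S.symmetryAlgebra hU →ₗ[𝕜] Fin 10 → 𝕜, ∀ v, ∃ V, S.IsSymmetry V ∧
      (∀ z : S.U, v.1 z = V z) ∧ L v = initialTaylorCoeffs V z₀ := by
  choose rep hrep hrep_eq using fun v : S.symmetryAlgebra hU => v.2
  have comb (a b : 𝕜) {v v₁ v₂ : S.symmetryAlgebra hU} (hv : v = a • v₁ + b • v₂) :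
      initialTaylorCoeffs (rep v) z₀ =
        a • initialTaylorCoeffs (rep v₁) z₀ + b • initialTaylorCoeffs (rep v₂) z₀ := by
    refine initialTaylorCoeffs_comb hU (hrep v₁).1 (hrep v₂).1 (fun z hz => ?_) hz₀
    rw [← hrep_eq v ⟨z, hz⟩, ← hrep_eq v₁ ⟨z, hz⟩, ← hrep_eq v₂ ⟨z, hz⟩, hv]
    rfl
  refine ⟨{ toFun := fun v => initialTaylorCoeffs (rep v) z₀
            map_add' := fun v₁ v₂ => ?_
            map_smul' := fun a v => ?_ }, fun v => ⟨rep v, hrep v, hrep_eq v, rfl⟩⟩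
  · simpa using comb 1 1 (show v₁ + v₂ = (1 : 𝕜) • v₁ + (1 : 𝕜) • v₂ by simp)
  · simpa using comb a 0 (show a • v = a • v + (0 : 𝕜) • v by simp)

theorem rank_symmetryAlgebra_le (hS : S.IsSmooth) (hF2 : ∀ z ∈ S.U, S.F2 z ≠ 0)
    (hU : IsPreconnected S.U) : Module.rank 𝕜 (S.symmetryAlgebra hS.isOpen_U) ≤ 10 := by
  obtain hempty | ⟨z₀, hz₀⟩ := S.U.eq_empty_or_nonempty
  · have : IsEmpty S.U := Set.isEmpty_coe_sort.2 hempty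
    rw [rank_subsingleton']
    exact zero_le
  obtain ⟨L, hL⟩ := exists_initialTaylorCoeffs_linearMap S hS.isOpen_U hz₀
  have hinj : Function.Injective L := fun v₁ v₂ h => by
    obtain ⟨V₁, hV₁, hv₁, hLV₁⟩ := hL v₁
    obtain ⟨V₂, hV₂, hv₂, hLV₂⟩ := hL v₂
    refine Subtype.ext (funext fun z => ?_)
    rw [hv₁ z, hv₂ z]
    exact hV₁.eq_of_initialTaylorCoeffs_eq hV₂ hS hF2 hU hz₀ (hLV₁.symm.trans (h.trans hLV₂)) z z.2
  simpa using LinearMap.rank_le_of_injective L hinj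

end System

end InitialTaylorCoeffs

end

end LieSymmetry

theorem mainTheorem1_general {𝕜 : Type*} [RCLike 𝕜] (S : LieSymmetry.System 𝕜)
    (hS : S.IsSmooth) (hUconn : IsPreconnected S.U) (hF2ne : ∀ z ∈ S.U, S.F2 z ≠ 0) :
    (∀ V₁ V₂ : LieSymmetry.Pt 𝕜 → LieSymmetry.Pt 𝕜, S.IsSymmetry V₁ → S.IsSymmetry V₂ →
      ∀ z₀ ∈ S.U,
        LieSymmetry.initialTaylorCoeffs V₁ z₀ = LieSymmetry.initialTaylorCoeffs V₂ z₀ →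
        ∀ z ∈ S.U, V₁ z = V₂ z) ∧
    Module.rank 𝕜 (S.symmetryAlgebra hS.isOpen_U) ≤ 10 :=
  ⟨fun _ _ hV₁ hV₂ _ hz₀ h0 => hV₁.eq_of_initialTaylorCoeffs_eq hV₂ hS hF2ne hUconn hz₀ h0,
    LieSymmetry.System.rank_symmetryAlgebra_le hS hF2ne hUconn⟩

theorem mainTheorem1 {𝕜 : Type*} [RCLike 𝕜] (S : LieSymmetry.System 𝕜)
    (hU : IsOpen S.U) (hUconn : IsPreconnected S.U) (hW : IsOpen S.W)
    (hUW : ∀ x y u : 𝕜, (x, y, u) ∈ S.U → (x, y, u, 0) ∈ S.W)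
    (hF1 : AnalyticOnNhd 𝕜 S.F1 S.U) (hF2 : AnalyticOnNhd 𝕜 S.F2 S.U)
    (hF3 : AnalyticOnNhd 𝕜 S.F3 S.W) (hG : AnalyticOnNhd 𝕜 S.G S.W)
    (hF2ne : ∀ z ∈ S.U, S.F2 z ≠ 0) :
    (∀ V₁ V₂ : LieSymmetry.Pt 𝕜 → LieSymmetry.Pt 𝕜, S.IsSymmetry V₁ → S.IsSymmetry V₂ →
      ∀ z₀ ∈ S.U,
        LieSymmetry.initialTaylorCoeffs V₁ z₀ = LieSymmetry.initialTaylorCoeffs V₂ z₀ →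
        ∀ z ∈ S.U, V₁ z = V₂ z) ∧
    Module.rank 𝕜 (S.symmetryAlgebra hU) ≤ 10 :=
  mainTheorem1_general S ⟨hU, hW, hUW, hF1.contDiffOn hU.uniqueDiffOn,
    hF2.contDiffOn hU.uniqueDiffOn, hF3.contDiffOn hW.uniqueDiffOn,
    hG.contDiffOn hW.uniqueDiffOn⟩ hUconn hF2ne
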